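/- Let $\mathcal H_A=\mathcal H_B=\mathbb{C}^2$ with standard basis $|0\rangle,|1\rangle$; an operator is called real if its matrix elements in the standard basis are real. Let $\rho_{AB}$ be a real density operator on $\mathbb{C}^2\otimes\mathbb{C}^2$ (positive semidefinite, trace one, real), and put $\rho_B=\mathrm{Tr}_A\,\rho_{AB}$. For $\theta\in\mathbb{R}$ let $|\theta\rangle=\cos\frac{\theta}{2}|0\rangle+\sin\frac{\theta}{2}|1\rangle$ and let $$\tilde\rho_B(\theta)=\mathrm{Tr}_A\big[(|\theta\rangle\langle\theta|\otimes\mathbb{I})\,\rho_{AB}\big]$$ (the steering ellipse of $\rho_{AB}$). For a real Hermitian operator $\lambda=\frac12(n\mathbb{I}+r_1\sigma_1+r_3\sigma_3)$ on $\mathbb{C}^2$, where $\sigma_1=|0\rangle\langle1|+|1\rangle\langle0|$ and $\sigma_3=|0\rangle\langle0|-|1\rangle\langle1|$, let $\mathrm{Tilt}(\lambda)=\sqrt{r_1^2+r_3^2}/|n|$, with $\mathrm{Tilt}(\lambda)=\infty$ if $n=0$. The tilt of the steering ellipse is the tilt of any nonzero real Hermitian operator that is normal, with respect to $\langle X,Y\rangle=\mathrm{Tr}(X^\dagger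 Y)$, to the affine space spanned by $\{\tilde\rho_B(\theta)\mid\theta\in\mathbb{R}\}$ if this space is two-dimensional, and $\infty$ otherwise. For real Hermitian $X,Y$ with $Y$ invertible let $|X|_Y=Y^{-1}\,|YXY|\,Y^{-1}$, where $|Z|=\sqrt{Z^\dagger Z}$. Suppose that the steering ellipse of $\rho_{AB}$ has tilt $<1$. Then there is a positive definite real density operator $Y$ on $\mathbb{C}^2$ such that $$\int_0^{2\pi}\Big|\frac{d}{d\theta}\tilde\rho_B(\theta)\Big|_Y\,d\theta$$ is (well defined and) a scalar multiple of $\rho_B$. -/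

import Mathlib

open scoped ENNReal Kronecker ComplexOrder MatrixOrder Matrix.Norms.L2Operator

/-- A matrix on a finite-dimensional space with standard basis indexed by `ι` is real if all of its
matrix elements in the standard basis are real numbers. -/
def IsRealMatrix {ι : Type*} (M : Matrix ι ι ℂ) : Prop :=
  ∀ i j, (M i j).im = 0

/-- Real density operators: real, positive semidefinite, of trace one. -/
structure IsRealDensity {ι : Type*} [Fintype ι] (M : Matrix ι ι ℂ) : Prop where
  real : IsRealMatrix M
  posSemidef : M.PosSemidef
  trace_eq_one : M.trace = 1

/-- Positive definite real density operators. -/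
structure IsPosDefRealDensity {ι : Type*} [Fintype ι] (M : Matrix ι ι ℂ) : Prop where
  real : IsRealMatrix M
  posDef : M.PosDef
  trace_eq_one : M.trace = 1

/-- The partial trace over the first tensor factor. -/
def partialTraceA (M : Matrix (Fin 2 × Fin 2) (Fin 2 × Fin 2) ℂ) : Matrix (Fin 2) (Fin 2) ℂ :=
  Matrix.of fun i j => ∑ k, M (k, i) (k, j)

/-- The reduced operator `ρ_B = Tr_A ρ_AB`. -/
def reducedB (ρ : Matrix (Fin 2 × Fin 2) (Fin 2 × Fin 2) ℂ) : Matrix (Fin 2) (Fin 2) ℂ :=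
  partialTraceA ρ

/-- The vector `|θ⟩ = cos (θ/2) |0⟩ + sin (θ/2) |1⟩`. -/
noncomputable def ketTheta (θ : ℝ) : Fin 2 → ℂ :=
  ![(Real.cos (θ / 2) : ℂ), (Real.sin (θ / 2) : ℂ)]

/-- The projector `|θ⟩⟨θ|`. -/
noncomputable def projTheta (θ : ℝ) : Matrix (Fin 2) (Fin 2) ℂ :=
  Matrix.vecMulVec (ketTheta θ) (star (ketTheta θ))

/-- The steering ellipse of `ρ_AB` on `B`: `θ ↦ Tr_A ((|θ⟩⟨θ| ⊗ 𝕀) ρ_AB)`. -/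
noncomputable def steeringEllipse (ρ : Matrix (Fin 2 × Fin 2) (Fin 2 × Fin 2) ℂ) (θ : ℝ) :
    Matrix (Fin 2) (Fin 2) ℂ :=
  partialTraceA ((projTheta θ ⊗ₖ (1 : Matrix (Fin 2) (Fin 2) ℂ)) * ρ)

/-- The Pauli matrix `σ₁ = |0⟩⟨1| + |1⟩⟨0|`. -/
def pauliOne : Matrix (Fin 2) (Fin 2) ℂ := !![0, 1; 1, 0]

/-- The Pauli matrix `σ₃ = |0⟩⟨0| - |1⟩⟨1|`. -/
def pauliThree : Matrix (Fin 2) (Fin 2) ℂ := !![1, 0; 0, -1]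

/-- The coordinate `n` in `L = (n 𝕀 + r₁ σ₁ + r₃ σ₃) / 2`. -/
def coordN (L : Matrix (Fin 2) (Fin 2) ℂ) : ℝ := L.trace.re

/-- The coordinate `r₁` in `L = (n 𝕀 + r₁ σ₁ + r₃ σ₃) / 2`. -/
def coordOne (L : Matrix (Fin 2) (Fin 2) ℂ) : ℝ := (pauliOne * L).trace.re

/-- The coordinate `r₃` in `L = (n 𝕀 + r₁ σ₁ + r₃ σ₃) / 2`. -/
def coordThree (L : Matrix (Fin 2) (Fin 2) ℂ) : ℝ := (pauliThree * L).trace.re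

theorem coordN_eq (L : Matrix (Fin 2) (Fin 2) ℂ) : coordN L = (L 0 0).re + (L 1 1).re := by
  simp [coordN, Matrix.trace_fin_two]

theorem coordOne_eq (L : Matrix (Fin 2) (Fin 2) ℂ) : coordOne L = (L 0 1).re + (L 1 0).re := by
  simp [coordOne, pauliOne, Matrix.trace_fin_two, Matrix.vecMul, dotProduct, Fin.sum_univ_two]
  ring

theorem coordThree_eq (L : Matrix (Fin 2) (Fin 2) ℂ) :
    coordThree L = (L 0 0).re - (L 1 1).re := by
  simp [coordThree, pauliThree, Matrix.trace_fin_two, Matrix.vecMul, dotProduct, Fin.sum_univ_two]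
  ring

/-- Every real Hermitian `2 × 2` matrix is `(n 𝕀 + r₁ σ₁ + r₃ σ₃) / 2` for exactly one triple of
real numbers, the one given by `coordN`, `coordOne`, `coordThree`. -/
theorem eq_bloch_iff {L : Matrix (Fin 2) (Fin 2) ℂ} (hL : L.IsHermitian) (hr : IsRealMatrix L)
    (n r₁ r₃ : ℝ) :
    L = (1 / 2 : ℝ) • (n • (1 : Matrix (Fin 2) (Fin 2) ℂ) + r₁ • pauliOne + r₃ • pauliThree) ↔
      n = coordN L ∧ r₁ = coordOne L ∧ r₃ = coordThree L := by
  have h01 : (L 1 0).re = (L 0 1).re := by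
    have := congrArg Complex.re (hL.apply 0 1)
    simpa using this
  have i00 := hr 0 0
  have i01 := hr 0 1
  have i10 := hr 1 0
  have i11 := hr 1 1
  rw [coordN_eq, coordOne_eq, coordThree_eq]
  constructor
  · intro h
    have e00 := congrArg Complex.re (congrFun (congrFun h 0) 0)
    have e01 := congrArg Complex.re (congrFun (congrFun h 0) 1)
    have e11 := congrArg Complex.re (congrFun (congrFun h 1) 1)
    simp [pauliOne, pauliThree] at e00 e01 e11
    refine ⟨?_, ?_, ?_⟩ <;> linarith
  · rintro ⟨rfl, rfl, rfl⟩
    ext i j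
    fin_cases i <;> fin_cases j <;> apply Complex.ext <;>
      simp [pauliOne, pauliThree, i00, i01, i10, i11, h01] <;> ring

/-- The tilt `√(r₁² + r₃²) / |n|` of a real Hermitian operator, equal to `∞` if `n = 0`. -/
noncomputable def tilt (L : Matrix (Fin 2) (Fin 2) ℂ) : ℝ≥0∞ :=
  if coordN L = 0 then ∞
  else ENNReal.ofReal (√(coordOne L ^ 2 + coordThree L ^ 2) / |coordN L|)

/-- The direction of the real affine space spanned by the steering ellipse. -/
noncomputable def steeringDirection (ρ : Matrix (Fin 2 × Fin 2) (Fin 2 × Fin 2) ℂ) :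
    Submodule ℝ (Matrix (Fin 2) (Fin 2) ℂ) :=
  (affineSpan ℝ (Set.range (steeringEllipse ρ))).direction

/-- `H` is a nonzero real Hermitian operator that is normal, for the inner product
`⟨X, Y⟩ = Tr (X† Y)`, to the affine space spanned by the steering ellipse. -/
structure IsSteeringNormal (ρ : Matrix (Fin 2 × Fin 2) (Fin 2 × Fin 2) ℂ)
    (H : Matrix (Fin 2) (Fin 2) ℂ) : Prop where
  isHermitian : H.IsHermitian
  real : IsRealMatrix H
  ne_zero : H ≠ 0
  normal : ∀ V ∈ steeringDirection ρ, (H.conjTranspose * V).trace = 0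

open Classical in
/-- The tilt of the steering ellipse: if the ellipse spans a two-dimensional affine space, the
common value of the tilts of its nonzero normal vectors (they all agree, see
`steeringTilt_eq_tilt`, so that the infimum is that value); otherwise `∞`. -/
noncomputable def steeringTilt (ρ : Matrix (Fin 2 × Fin 2) (Fin 2 × Fin 2) ℂ) : ℝ≥0∞ :=
  if Module.finrank ℝ (steeringDirection ρ) = 2 then
    ⨅ (H : Matrix (Fin 2) (Fin 2) ℂ) (_ : IsSteeringNormal ρ H), tilt H
  else ∞

theorem projTheta_apply (θ : ℝ) (k l : Fin 2) :
    projTheta θ k l =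
      ((![Real.cos (θ / 2), Real.sin (θ / 2)] k * ![Real.cos (θ / 2), Real.sin (θ / 2)] l : ℝ) :
        ℂ) := by
  have h : ketTheta θ = fun k => ((![Real.cos (θ / 2), Real.sin (θ / 2)] k : ℝ) : ℂ) := by
    funext k
    fin_cases k <;> simp [ketTheta]
  rw [projTheta, Matrix.vecMulVec_apply, h]
  simp only [Pi.star_apply, Complex.star_def, Complex.conj_ofReal, Complex.ofReal_mul]

theorem steeringEllipse_apply (ρ : Matrix (Fin 2 × Fin 2) (Fin 2 × Fin 2) ℂ) (θ : ℝ)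
    (i j : Fin 2) :
    steeringEllipse ρ θ i j = ∑ k, ∑ l,
      ((![Real.cos (θ / 2), Real.sin (θ / 2)] k * ![Real.cos (θ / 2), Real.sin (θ / 2)] l : ℝ) :
        ℂ) * ρ (l, i) (k, j) := by
  simp only [steeringEllipse, partialTraceA, Matrix.of_apply, Matrix.mul_apply,
    Fintype.sum_prod_type, Matrix.kronecker_apply, projTheta_apply, Matrix.one_apply, mul_ite,
    mul_one, mul_zero, ite_mul, zero_mul, Finset.sum_ite_eq, Finset.mem_univ, if_true]

/-- The steering ellipse of a real state consists of real Hermitian operators. -/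
theorem steeringEllipse_real {ρ : Matrix (Fin 2 × Fin 2) (Fin 2 × Fin 2) ℂ} (hρ : IsRealDensity ρ)
    (θ : ℝ) : (steeringEllipse ρ θ).IsHermitian ∧ IsRealMatrix (steeringEllipse ρ θ) := by
  constructor
  · ext i j
    rw [Matrix.conjTranspose_apply, steeringEllipse_apply, steeringEllipse_apply, star_sum,
      Finset.sum_comm]
    refine Finset.sum_congr rfl fun k _ => ?_
    rw [star_sum]
    refine Finset.sum_congr rfl fun l _ => ?_
    rw [star_mul', hρ.posSemidef.isHermitian.apply, Complex.star_def, Complex.conj_ofReal,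
      mul_comm (![Real.cos (θ / 2), Real.sin (θ / 2)] k)]
  · intro i j
    rw [steeringEllipse_apply, Complex.im_sum]
    refine Finset.sum_eq_zero fun k _ => ?_
    rw [Complex.im_sum]
    refine Finset.sum_eq_zero fun l _ => ?_
    rw [Complex.im_ofReal_mul, hρ.real, mul_zero]

/-- The steering ellipse is a smooth curve, so its derivative is the usual one. -/
theorem differentiable_steeringEllipse (ρ : Matrix (Fin 2 × Fin 2) (Fin 2 × Fin 2) ℂ) :
    Differentiable ℝ (steeringEllipse ρ) := by
  rw [show steeringEllipse ρ = fun θ i j => steeringEllipse ρ θ i j from rfl]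
  refine differentiable_pi.2 fun i => differentiable_pi.2 fun j => ?_
  simp only [steeringEllipse_apply, Fin.sum_univ_two, Matrix.cons_val_zero, Matrix.cons_val_one]
  fun_prop

/-- All nonzero normals of a non-degenerate steering ellipse have the same tilt. -/
theorem tilt_eq_of_isSteeringNormal {ρ : Matrix (Fin 2 × Fin 2) (Fin 2 × Fin 2) ℂ}
    (hρ : IsRealDensity ρ) (h2 : Module.finrank ℝ (steeringDirection ρ) = 2)
    {H K : Matrix (Fin 2) (Fin 2) ℂ} (hH : IsSteeringNormal ρ H) (hK : IsSteeringNormal ρ K) :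
    tilt H = tilt K := by
  let S : Submodule ℝ (Matrix (Fin 2) (Fin 2) ℂ) :=
    { carrier := {M | M.IsHermitian ∧ IsRealMatrix M}
      add_mem' := fun {a b} ha hb => ⟨ha.1.add hb.1, fun i j => by
        simp [ha.2 i j, hb.2 i j]⟩
      zero_mem' := ⟨Matrix.isHermitian_zero, fun i j => by simp⟩
      smul_mem' := fun c a ha => ⟨by
        rw [Matrix.IsHermitian, Matrix.conjTranspose_smul, ha.1.eq, star_trivial], fun i j => by
        simp [ha.2 i j]⟩ }
  have hWS : steeringDirection ρ ≤ S := by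
    rw [steeringDirection, direction_affineSpan, vectorSpan_def, Submodule.span_le]
    rintro _ ⟨_, ⟨s, rfl⟩, _, ⟨t, rfl⟩, rfl⟩
    exact S.sub_mem (steeringEllipse_real hρ s) (steeringEllipse_real hρ t)
  let φ : Matrix (Fin 2) (Fin 2) ℂ →ₗ[ℝ] EuclideanSpace ℝ (Fin 3) :=
    { toFun := fun L => !₂[coordN L, coordOne L, coordThree L]
      map_add' := fun a b => by
        ext i
        fin_cases i <;> simp [coordN_eq, coordOne_eq, coordThree_eq] <;> ring
      map_smul' := fun c a => by
        ext i
        fin_cases i <;> simp [coordN_eq, coordOne_eq, coordThree_eq] <;> ring }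
  have hφ0 : ∀ L, φ L 0 = coordN L := fun L => rfl
  have hφ1 : ∀ L, φ L 1 = coordOne L := fun L => rfl
  have hφ2 : ∀ L, φ L 2 = coordThree L := fun L => rfl
  have hinj : ∀ L ∈ S, φ L = 0 → L = 0 := by
    rintro L ⟨h1, h3⟩ h0
    rw [(eq_bloch_iff h1 h3 _ _ _).2 ⟨rfl, rfl, rfl⟩, ← hφ0, ← hφ1, ← hφ2, h0]
    simp
  let W : Submodule ℝ (EuclideanSpace ℝ (Fin 3)) := (steeringDirection ρ).map φ
  have hW : Module.finrank ℝ W = 2 := by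
    rw [← h2]
    have hi : Function.Injective (φ.domRestrict (steeringDirection ρ)) := by
      rw [← LinearMap.ker_eq_bot, LinearMap.ker_eq_bot']
      intro m hm
      exact Subtype.ext (hinj m (hWS m.2) hm)
    have := LinearMap.finrank_range_of_inj hi
    rwa [LinearMap.range_domRestrict] at this
  have hperp : Module.finrank ℝ Wᗮ = 1 := by
    have := W.finrank_add_finrank_orthogonal
    rw [hW, finrank_euclideanSpace_fin] at this
    omega
  have hmem : ∀ M, IsSteeringNormal ρ M → φ M ∈ Wᗮ := by
    intro M hM
    rw [Submodule.mem_orthogonal]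
    rintro _ ⟨V, hV, rfl⟩
    have h0 := congrArg Complex.re (hM.normal V hV)
    have hVS := hWS hV
    have a1 : (V 1 0).re = (V 0 1).re := by
      have := congrArg Complex.re (hVS.1.apply 0 1)
      simpa using this
    have a2 : (M 1 0).re = (M 0 1).re := by
      have := congrArg Complex.re (hM.isHermitian.apply 0 1)
      simpa using this
    rw [hM.isHermitian.eq] at h0
    simp only [Matrix.trace_fin_two, Matrix.mul_apply, Fin.sum_univ_two, Complex.add_re,
      Complex.mul_re, hM.real _ _, zero_mul, sub_zero, Complex.zero_re] at h0
    rw [PiLp.inner_apply, Fin.sum_univ_three, hφ0, hφ1, hφ2, hφ0, hφ1, hφ2]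
    simp only [coordN_eq, coordOne_eq, coordThree_eq, RCLike.inner_apply,
      conj_trivial]
    rw [a1, a2] at *
    linarith
  have hne : (⟨φ H, hmem H hH⟩ : Wᗮ) ≠ 0 := fun h =>
    hH.ne_zero (hinj H ⟨hH.isHermitian, hH.real⟩ (congrArg Subtype.val h))
  obtain ⟨c, hc⟩ := (finrank_eq_one_iff_of_nonzero' _ hne).1 hperp ⟨φ K, hmem K hK⟩
  have hc' : c • φ H = φ K := congrArg Subtype.val hc
  have hc0 : c ≠ 0 := by
    rintro rfl
    exact hK.ne_zero (hinj K ⟨hK.isHermitian, hK.real⟩ (by rw [← hc', zero_smul]))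
  have k0 : coordN K = c * coordN H := by rw [← hφ0, ← hc', ← hφ0]; rfl
  have k1 : coordOne K = c * coordOne H := by rw [← hφ1, ← hc', ← hφ1]; rfl
  have k2 : coordThree K = c * coordThree H := by rw [← hφ2, ← hc', ← hφ2]; rfl
  have hs : (c * coordOne H) ^ 2 + (c * coordThree H) ^ 2 =
      |c| ^ 2 * (coordOne H ^ 2 + coordThree H ^ 2) := by
    rw [sq_abs]; ring
  rw [tilt, tilt, k0, k1, k2, hs, Real.sqrt_mul (sq_nonneg _), Real.sqrt_sq (abs_nonneg c),
    abs_mul, mul_div_mul_left _ _ (abs_ne_zero.2 hc0)]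
  simp [hc0]

theorem steeringTilt_eq_tilt {ρ : Matrix (Fin 2 × Fin 2) (Fin 2 × Fin 2) ℂ}
    (hρ : IsRealDensity ρ) (h2 : Module.finrank ℝ (steeringDirection ρ) = 2)
    {H : Matrix (Fin 2) (Fin 2) ℂ} (hH : IsSteeringNormal ρ H) : steeringTilt ρ = tilt H := by
  rw [steeringTilt, if_pos h2]
  refine le_antisymm (iInf₂_le H hH) (le_iInf₂ fun K hK => ?_)
  exact (tilt_eq_of_isSteeringNormal hρ h2 hH hK).le

/-- The absolute value `|X|_Y = Y⁻¹ |Y X Y| Y⁻¹`, where `|Z| = √(Z† Z)`. -/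
noncomputable def absRel (Y X : Matrix (Fin 2) (Fin 2) ℂ) : Matrix (Fin 2) (Fin 2) ℂ :=
  Y⁻¹ * CFC.abs (Y * X * Y) * Y⁻¹

/-! The equation is the Lagrange condition of a maximisation problem. Write `X θ` for the derivative
of the ellipse. For positive definite `m = Y²` and `det X < 0`, the eigenvalues of `YXY`, which are
those of `mX`, have opposite signs, so `Tr |YXY|` is their difference, `symGap m X`. The gradient of
this quantity in `m` is `|X|_Y`. Hence a positive definite maximiser of `F m = ∫ symGap m (X θ)`,
the function `gapIntegral`, under the constraint `Tr (m ρ_B) = 1` satisfies `∫ |X|_Y = c ρ_B`, with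
`c` the maximal value.

Tilt `< 1` says that the normal of the ellipse is a definite matrix. Nonzero matrices orthogonal to
a definite one are indefinite, so `det X θ < 0` for all `θ` (`symDet_derivCoord_neg`). This also
forces `ρ_B` to be positive definite (`posDef_reducedB`), which makes the constrained set of
positive semidefinite `m` compact, so that a maximiser exists (`exists_gapIntegral_max`).

The main point is that the maximiser is not singular (`symDet_pos_of_gapIntegral_max`). For singular
`m` the integrand is `|Tr (m X θ)|`, and it vanishes somewhere because `X (θ + π) = -X θ`. Moving
`m` by `ε` towards an interior point costs at most `O(ε)`, but near the zero the kink `|a|` is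
replaced by at least `√(a² + εδ)`, which gains a multiple of `ε log (1/ε)`. For small `ε` the gain
wins.

At an interior maximiser the Lagrange condition is derived without differentiating the integral:
Cauchy–Schwarz gives a minorant of `F`, linear plus a multiple of `√det`, that touches it at `m`
(`gapIntegral_ge`, `gapIntegral_eq`, `critical_of_gapIntegral_max`). Finally `absRel_symMat`
identifies the integrand with `|X|_Y`, where `Y` is the multiple of `√m` of trace one; rescaling `Y`
does not change `|X|_Y`. -/

/-! ### Real symmetric matrices as triples, and the functional to be maximised. -/

/-- The trace of the product of the symmetric matrices `!![m.1, m.2.1; m.2.1, m.2.2]` and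
`!![k.1, k.2.1; k.2.1, k.2.2]`. -/
def symPair (m k : ℝ × ℝ × ℝ) : ℝ := m.1 * k.1 + 2 * m.2.1 * k.2.1 + m.2.2 * k.2.2

/-- The determinant of the symmetric matrix `!![m.1, m.2.1; m.2.1, m.2.2]`. -/
def symDet (m : ℝ × ℝ × ℝ) : ℝ := m.1 * m.2.2 - m.2.1 ^ 2

/-- Positive semidefiniteness of the symmetric matrix `!![m.1, m.2.1; m.2.1, m.2.2]`. -/
def SymPSD (m : ℝ × ℝ × ℝ) : Prop := 0 ≤ m.1 ∧ 0 ≤ m.2.2 ∧ 0 ≤ symDet m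

/-- The difference of the eigenvalues of the product of two symmetric matrices. -/
noncomputable def symGap (m k : ℝ × ℝ × ℝ) : ℝ := √(symPair m k ^ 2 - 4 * symDet m * symDet k)

/-- The integral of `symGap m` along a closed curve of symmetric matrices. -/
noncomputable def gapIntegral (X : ℝ → ℝ × ℝ × ℝ) (m : ℝ × ℝ × ℝ) : ℝ :=
  ∫ θ in (0 : ℝ)..(2 * Real.pi), symGap m (X θ)

theorem continuous_symPair : Continuous fun a : (ℝ × ℝ × ℝ) × (ℝ × ℝ × ℝ) => symPair a.1 a.2 := by
  unfold symPair; fun_prop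

theorem continuous_symDet : Continuous symDet := by
  unfold symDet; fun_prop

theorem continuous_symGap : Continuous fun a : (ℝ × ℝ × ℝ) × (ℝ × ℝ × ℝ) => symGap a.1 a.2 := by
  unfold symGap symPair symDet; fun_prop

theorem continuous_symGap_comp {X : ℝ → ℝ × ℝ × ℝ} (hX : Continuous X) (m : ℝ × ℝ × ℝ) :
    Continuous fun θ => symGap m (X θ) :=
  continuous_symGap.comp (continuous_const.prodMk hX)

theorem continuous_symPair_comp {X : ℝ → ℝ × ℝ × ℝ} (hX : Continuous X) (m : ℝ × ℝ × ℝ) :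
    Continuous fun θ => symPair m (X θ) :=
  continuous_symPair.comp (continuous_const.prodMk hX)

theorem continuous_gapIntegral {X : ℝ → ℝ × ℝ × ℝ} (hX : Continuous X) :
    Continuous (gapIntegral X) := by
  unfold gapIntegral
  refine intervalIntegral.continuous_parametric_intervalIntegral_of_continuous' ?_ _ _
  exact continuous_symGap.comp (continuous_fst.prodMk (hX.comp continuous_snd))

theorem symGap_smul {k : ℝ} (hk : 0 ≤ k) (m n : ℝ × ℝ × ℝ) :
    symGap (k • m) n = k * symGap m n := by
  have h : symPair (k • m) n ^ 2 - 4 * symDet (k • m) * symDet n =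
      k ^ 2 * (symPair m n ^ 2 - 4 * symDet m * symDet n) := by
    simp only [symPair, symDet, Prod.smul_fst, Prod.smul_snd, smul_eq_mul]; ring
  rw [symGap, h, Real.sqrt_mul (sq_nonneg k), Real.sqrt_sq hk, symGap]

theorem gapIntegral_smul {k : ℝ} (hk : 0 ≤ k) (X : ℝ → ℝ × ℝ × ℝ) (m : ℝ × ℝ × ℝ) :
    gapIntegral X (k • m) = k * gapIntegral X m := by
  simp only [gapIntegral, symGap_smul hk, intervalIntegral.integral_const_mul]

theorem symPair_nonneg {m k : ℝ × ℝ × ℝ} (hm : SymPSD m) (hk : SymPSD k) : 0 ≤ symPair m k := by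
  obtain ⟨x, y, z⟩ := m
  obtain ⟨p, q, r⟩ := k
  obtain ⟨h1, h2, h3⟩ := hm
  obtain ⟨k1, k2, k3⟩ := hk
  simp only [symDet, symPair] at *
  have a1 : y ^ 2 * q ^ 2 ≤ (x * z) * (p * r) := by gcongr <;> linarith
  have a2 : (2 * y * q) ^ 2 ≤ (x * p + z * r) ^ 2 := by
    nlinarith [sq_nonneg (x * p - z * r)]
  have := abs_le_of_sq_le_sq' a2 (by positivity)
  linarith [this.1]

theorem SymPSD.smul {k : ℝ} (hk : 0 ≤ k) {m : ℝ × ℝ × ℝ} (hm : SymPSD m) : SymPSD (k • m) := by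
  obtain ⟨h1, h2, h3⟩ := hm
  refine ⟨mul_nonneg hk h1, mul_nonneg hk h2, ?_⟩
  have : symDet (k • m) = k ^ 2 * symDet m := by
    simp only [symDet, Prod.smul_fst, Prod.smul_snd, smul_eq_mul]; ring
  rw [this]; positivity

/-! ### Compactness of the constraint set and existence of a maximiser. -/

theorem symPair_coercive {ρ : ℝ × ℝ × ℝ} (h0 : 0 < ρ.1) (hd : 0 < symDet ρ) :
    ∃ κ > 0, ∀ m, SymPSD m → κ * (m.1 + m.2.2) ≤ symPair m ρ := by
  obtain ⟨u, v, w⟩ := ρ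
  simp only [symDet] at h0 hd
  have hw : 0 < w := by nlinarith [sq_nonneg v]
  -- Determinant over trace is a lower bound for the smaller eigenvalue of `ρ`; the shifted matrix
  -- `ρ - κ` has determinant exactly `κ²`.
  refine ⟨(u * w - v ^ 2) / (u + w), by positivity, fun m hm => ?_⟩
  set κ := (u * w - v ^ 2) / (u + w) with hκ
  have e : κ * (u + w) = u * w - v ^ 2 := by rw [hκ]; field_simp
  have hp : SymPSD (u - κ, v, w - κ) := by
    refine ⟨?_, ?_, ?_⟩
    · have : 0 ≤ (u - κ) * (u + w) := by nlinarith [sq_nonneg v, sq_nonneg u]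
      exact nonneg_of_mul_nonneg_left this (by positivity)
    · have : 0 ≤ (w - κ) * (u + w) := by nlinarith [sq_nonneg v, sq_nonneg w]
      exact nonneg_of_mul_nonneg_left this (by positivity)
    · simp only [symDet]; nlinarith [sq_nonneg κ]
  have := symPair_nonneg hm hp
  simp only [symPair] at this ⊢
  linarith

theorem isCompact_symPSD_slice {ρ : ℝ × ℝ × ℝ} (h0 : 0 < ρ.1) (hd : 0 < symDet ρ) :
    IsCompact {m | SymPSD m ∧ symPair m ρ = 1} := by
  obtain ⟨κ, hκ, hc⟩ := symPair_coercive h0 hd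
  refine IsCompact.of_isClosed_subset
    (isCompact_Icc (a := ((-(1 / κ), -(1 / κ), -(1 / κ)) : ℝ × ℝ × ℝ))
      (b := (1 / κ, 1 / κ, 1 / κ))) ?_ ?_
  · have e : {m | SymPSD m ∧ symPair m ρ = 1} =
        {m : ℝ × ℝ × ℝ | 0 ≤ m.1} ∩ {m | 0 ≤ m.2.2} ∩ {m | 0 ≤ symDet m} ∩
          {m | symPair m ρ = 1} := by
      ext m; simp [SymPSD, and_assoc]
    rw [e]
    refine ((IsClosed.inter ?_ ?_).inter ?_).inter ?_
    · exact isClosed_le continuous_const (by fun_prop)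
    · exact isClosed_le continuous_const (by fun_prop)
    · exact isClosed_le continuous_const continuous_symDet
    · exact isClosed_eq (continuous_symPair.comp (continuous_id.prodMk continuous_const))
        continuous_const
  · rintro ⟨x, y, z⟩ ⟨hm, h1⟩
    have h2 := hc _ hm
    rw [h1] at h2
    obtain ⟨hx, hz, hdet⟩ := hm
    simp only [symDet] at hx hz hdet h2
    have h3 : x + z ≤ 1 / κ := by rw [le_div_iff₀ hκ]; linarith
    have hk : 0 < 1 / κ := by positivity
    have h4 : y ^ 2 ≤ (1 / κ) ^ 2 := by
      have : (x + z) ^ 2 ≤ (1 / κ) ^ 2 := by gcongr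
      nlinarith [mul_nonneg hx hz, sq_nonneg x, sq_nonneg z]
    have h5 := abs_le_of_sq_le_sq' h4 hk.le
    simp only [Set.mem_Icc, Prod.mk_le_mk]
    exact ⟨⟨by linarith, h5.1, by linarith⟩, by linarith, h5.2, by linarith⟩

/-- The normalised adjugate of `ρ`. -/
noncomputable def symCenter (ρ : ℝ × ℝ × ℝ) : ℝ × ℝ × ℝ :=
  (2 * symDet ρ)⁻¹ • (ρ.2.2, -ρ.2.1, ρ.1)

theorem symPair_symCenter {ρ : ℝ × ℝ × ℝ} (hd : 0 < symDet ρ) : symPair (symCenter ρ) ρ = 1 := by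
  have : symPair (symCenter ρ) ρ = (2 * symDet ρ)⁻¹ * (2 * symDet ρ) := by
    simp only [symPair, symCenter, Prod.smul_mk, smul_eq_mul, symDet]; ring
  rw [this, inv_mul_cancel₀ (by positivity)]

theorem symPSD_symCenter {ρ : ℝ × ℝ × ℝ} (h0 : 0 < ρ.1) (hd : 0 < symDet ρ) :
    SymPSD (symCenter ρ) := by
  have hw : 0 < ρ.2.2 := by
    have : 0 < ρ.1 * ρ.2.2 := by unfold symDet at hd; nlinarith [sq_nonneg ρ.2.1]
    exact pos_of_mul_pos_right this h0.le
  refine SymPSD.smul (by positivity) ⟨hw.le, h0.le, ?_⟩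
  simp only [symDet] at hd ⊢
  nlinarith

/-- Both sides of the final inequality are homogeneous of degree one in `n`, so the maximum over the
slice controls the whole cone. Later perturbations therefore need not stay on the slice. -/
theorem exists_gapIntegral_max {X : ℝ → ℝ × ℝ × ℝ} (hX : Continuous X) {ρ : ℝ × ℝ × ℝ}
    (h0 : 0 < ρ.1) (hd : 0 < symDet ρ) :
    ∃ m, SymPSD m ∧ symPair m ρ = 1 ∧
      ∀ n, SymPSD n → gapIntegral X n ≤ gapIntegral X m * symPair n ρ := by
  obtain ⟨m, ⟨hm, hm1⟩, hmax⟩ := (isCompact_symPSD_slice h0 hd).exists_isMaxOn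
    ⟨symCenter ρ, symPSD_symCenter h0 hd, symPair_symCenter hd⟩
    (continuous_gapIntegral hX).continuousOn
  refine ⟨m, hm, hm1, fun n hn => ?_⟩
  obtain ⟨κ, hκ, hc⟩ := symPair_coercive h0 hd
  have hcn := hc n hn
  have hρ : SymPSD ρ := by
    have : 0 < ρ.1 * ρ.2.2 := by unfold symDet at hd; nlinarith [sq_nonneg ρ.2.1]
    exact ⟨h0.le, (pos_of_mul_pos_right this h0.le).le, hd.le⟩
  -- A zero pairing cannot be normalised, but by coercivity it forces `n = 0`.
  rcases (symPair_nonneg hn hρ).eq_or_lt with h | h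
  · obtain ⟨x, y, z⟩ := n
    obtain ⟨hx, hz, hdet⟩ := hn
    rw [← h] at hcn ⊢
    simp only [symDet] at hx hz hdet hcn
    have hs : x + z ≤ 0 := by
      by_contra! hh
      exact absurd hcn (not_le.2 (mul_pos hκ hh))
    obtain rfl : x = 0 := by linarith
    obtain rfl : z = 0 := by linarith
    obtain rfl : y = 0 := by
      have : y ^ 2 = 0 := le_antisymm (by linarith) (sq_nonneg y)
      exact pow_eq_zero_iff two_ne_zero |>.1 this
    have := gapIntegral_smul le_rfl X (0 : ℝ × ℝ × ℝ)
    rw [zero_smul, zero_mul] at this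
    rw [mul_zero]
    exact this.le
  · have h1 : symPair ((symPair n ρ)⁻¹ • n) ρ = 1 := by
      have : symPair ((symPair n ρ)⁻¹ • n) ρ = (symPair n ρ)⁻¹ * symPair n ρ := by
        simp only [symPair, Prod.smul_fst, Prod.smul_snd, smul_eq_mul]; ring
      rw [this, inv_mul_cancel₀ h.ne']
    have h2 : gapIntegral X ((symPair n ρ)⁻¹ • n) ≤ gapIntegral X m :=
      hmax ⟨hn.smul (by positivity), h1⟩
    rw [gapIntegral_smul (by positivity), inv_mul_le_iff₀ h] at h2
    linarith

/-! ### The critical equation at an interior maximum. -/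

/-- The difference of the two sides in `h` vanishes at `s = 0` and is nonnegative nearby, so its
derivative at this local minimum is zero. -/
theorem eq_of_sqrt_tangent_le {a b E d e : ℝ} (hd : 0 < d)
    (h : ∀ᶠ s in nhds (0 : ℝ), E * (√(d + s * b + s ^ 2 * e) - √d) ≤ a * s) :
    a = E * (b / (2 * √d)) := by
  have hder : HasDerivAt (fun s : ℝ => a * s - E * (√(d + s * b + s ^ 2 * e) - √d))
      (a * 1 - E * ((0 + 1 * b + (2 : ℕ) * (0 : ℝ) ^ (2 - 1) * 1 * e) /
        (2 * √(d + 0 * b + 0 ^ 2 * e)))) 0 := by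
    refine ((hasDerivAt_id _).const_mul a).sub (HasDerivAt.const_mul E (HasDerivAt.sub_const _ ?_))
    refine HasDerivAt.sqrt ?_ (by simpa using hd.ne')
    exact ((hasDerivAt_const _ d).add ((hasDerivAt_id _).mul_const b)).add
      (((hasDerivAt_id _).pow 2).mul_const e)
  have hmin : IsLocalMin (fun s : ℝ => a * s - E * (√(d + s * b + s ^ 2 * e) - √d)) 0 := by
    filter_upwards [h] with s hs
    simp only [zero_mul, mul_zero, add_zero, ne_eq, OfNat.ofNat_ne_zero, not_false_eq_true,
      zero_pow, sub_self]
    linarith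
  have := hmin.hasDerivAt_eq_zero hder
  simp at this
  linarith

/-- For `det k ≤ 0`, `symGap m k` is the Euclidean norm of the vector `(Tr (mk), 2 √(det m) √(-det
k))`. This is Cauchy–Schwarz for two such vectors. -/
theorem symGap_mul_le {m n k : ℝ × ℝ × ℝ} (hm : 0 ≤ symDet m) (hn : 0 ≤ symDet n)
    (hk : symDet k ≤ 0) :
    symPair m k * symPair n k - 4 * (√(symDet m) * √(symDet n)) * symDet k ≤
      symGap m k * symGap n k := by
  rw [symGap, symGap, ← Real.sqrt_mul (x := symPair m k ^ 2 - 4 * symDet m * symDet k)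
    (by nlinarith [sq_nonneg (symPair m k), mul_nonneg hm (neg_nonneg.2 hk)])]
  apply Real.le_sqrt_of_sq_le
  have h1 := Real.sq_sqrt hm
  have h2 := Real.sq_sqrt hn
  set a := √(symDet m)
  set b := √(symDet n)
  rw [← h1, ← h2]
  have : 0 ≤ -symDet k * (symPair m k * b - symPair n k * a) ^ 2 :=
    mul_nonneg (by linarith) (sq_nonneg _)
  linarith

theorem symGap_pos {m k : ℝ × ℝ × ℝ} (hm : 0 < symDet m) (hk : symDet k < 0) :
    0 < symGap m k := by
  apply Real.sqrt_pos.2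
  nlinarith [sq_nonneg (symPair m k)]

/-- `symGap_mul_le` divided by `symGap m (X θ)` and integrated. As a function of `n` the left side
is linear plus a multiple of `√(symDet n)`; by `gapIntegral_eq` it equals `gapIntegral X n` at `n =
m`. -/
theorem gapIntegral_ge {X : ℝ → ℝ × ℝ × ℝ} (hX : Continuous X) (hneg : ∀ θ, symDet (X θ) < 0)
    {m n : ℝ × ℝ × ℝ} (hm : 0 < symDet m) (hn : 0 ≤ symDet n) :
    symPair n (∫ θ in (0 : ℝ)..(2 * Real.pi), symPair m (X θ) * (X θ).1 / symGap m (X θ),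
        ∫ θ in (0 : ℝ)..(2 * Real.pi), symPair m (X θ) * (X θ).2.1 / symGap m (X θ),
        ∫ θ in (0 : ℝ)..(2 * Real.pi), symPair m (X θ) * (X θ).2.2 / symGap m (X θ)) +
      (∫ θ in (0 : ℝ)..(2 * Real.pi), -4 * √(symDet m) * symDet (X θ) / symGap m (X θ)) *
        √(symDet n) ≤ gapIntegral X n := by
  have hpos : ∀ θ, symGap m (X θ) ≠ 0 := fun θ => (symGap_pos hm (hneg θ)).ne'
  have cg := continuous_symGap_comp hX m
  have cp := continuous_symPair_comp hX m
  have cd : Continuous fun θ => symDet (X θ) := continuous_symDet.comp hX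
  have i : ∀ f : ℝ → ℝ, Continuous f →
      IntervalIntegrable f MeasureTheory.volume 0 (2 * Real.pi) :=
    fun f hf => hf.intervalIntegrable _ _
  simp only [symPair] at cp ⊢
  rw [← intervalIntegral.integral_const_mul, ← intervalIntegral.integral_const_mul,
    ← intervalIntegral.integral_const_mul, ← intervalIntegral.integral_mul_const,
    ← intervalIntegral.integral_add, ← intervalIntegral.integral_add,
    ← intervalIntegral.integral_add]
  · refine intervalIntegral.integral_mono_on (by positivity) (i _ ?_) (i _ ?_) fun θ _ => ?_
    · fun_prop (disch := assumption)
    · exact continuous_symGap_comp hX n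
    · have hg := symGap_pos hm (hneg θ)
      have := symGap_mul_le hm.le hn (hneg θ).le
      rw [← div_le_iff₀' hg] at this
      refine le_trans (le_of_eq ?_) this
      simp only [symPair]
      field_simp
      ring
  all_goals exact i _ (by fun_prop (disch := assumption))

theorem gapIntegral_eq {X : ℝ → ℝ × ℝ × ℝ} (hX : Continuous X) (hneg : ∀ θ, symDet (X θ) < 0)
    {m : ℝ × ℝ × ℝ} (hm : 0 < symDet m) :
    symPair m (∫ θ in (0 : ℝ)..(2 * Real.pi), symPair m (X θ) * (X θ).1 / symGap m (X θ),
        ∫ θ in (0 : ℝ)..(2 * Real.pi), symPair m (X θ) * (X θ).2.1 / symGap m (X θ),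
        ∫ θ in (0 : ℝ)..(2 * Real.pi), symPair m (X θ) * (X θ).2.2 / symGap m (X θ)) +
      (∫ θ in (0 : ℝ)..(2 * Real.pi), -4 * √(symDet m) * symDet (X θ) / symGap m (X θ)) *
        √(symDet m) = gapIntegral X m := by
  have hpos : ∀ θ, symGap m (X θ) ≠ 0 := fun θ => (symGap_pos hm (hneg θ)).ne'
  have cg := continuous_symGap_comp hX m
  have cp := continuous_symPair_comp hX m
  have cd : Continuous fun θ => symDet (X θ) := continuous_symDet.comp hX
  have i : ∀ f : ℝ → ℝ, Continuous f →
      IntervalIntegrable f MeasureTheory.volume 0 (2 * Real.pi) :=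
    fun f hf => hf.intervalIntegrable _ _
  simp only [symPair] at cp ⊢
  rw [← intervalIntegral.integral_const_mul, ← intervalIntegral.integral_const_mul,
    ← intervalIntegral.integral_const_mul, ← intervalIntegral.integral_mul_const,
    ← intervalIntegral.integral_add, ← intervalIntegral.integral_add,
    ← intervalIntegral.integral_add]
  · refine intervalIntegral.integral_congr fun θ _ => ?_
    have h1 := Real.sq_sqrt hm.le
    have h2 : symGap m (X θ) ^ 2 = symPair m (X θ) ^ 2 - 4 * symDet m * symDet (X θ) :=
      Real.sq_sqrt (by nlinarith [sq_nonneg (symPair m (X θ)), mul_pos hm (neg_pos.2 (hneg θ))])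
    have hg := hpos θ
    rw [← h1] at h2
    simp only [symPair] at h2
    field_simp
    rw [h2]
    ring
  all_goals exact i _ (by fun_prop (disch := assumption))

/-- The critical equation at an interior maximum of `gapIntegral X` on the slice
`symPair m ρ = 1`. -/
theorem critical_of_gapIntegral_max {X : ℝ → ℝ × ℝ × ℝ} (hX : Continuous X)
    (hneg : ∀ θ, symDet (X θ) < 0) {m ρ : ℝ × ℝ × ℝ} (hm : SymPSD m) (hd : 0 < symDet m)
    (h1 : symPair m ρ = 1)
    (hmax : ∀ n, SymPSD n → gapIntegral X n ≤ gapIntegral X m * symPair n ρ) :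
    ∫ θ in (0 : ℝ)..(2 * Real.pi),
        (symPair m (X θ) * (X θ).1 - 2 * symDet (X θ) * m.2.2) / symGap m (X θ) =
      gapIntegral X m * ρ.1 ∧
    ∫ θ in (0 : ℝ)..(2 * Real.pi),
        (symPair m (X θ) * (X θ).2.1 + 2 * symDet (X θ) * m.2.1) / symGap m (X θ) =
      gapIntegral X m * ρ.2.1 ∧
    ∫ θ in (0 : ℝ)..(2 * Real.pi),
        (symPair m (X θ) * (X θ).2.2 - 2 * symDet (X θ) * m.1) / symGap m (X θ) =
      gapIntegral X m * ρ.2.2 := by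
  have hge := fun n hn => gapIntegral_ge hX hneg hd (n := n) hn
  have heq := gapIntegral_eq hX hneg hd
  have hpos : ∀ θ, symGap m (X θ) ≠ 0 := fun θ => (symGap_pos hd (hneg θ)).ne'
  have cg := continuous_symGap_comp hX m
  have cp := continuous_symPair_comp hX m
  have cd : Continuous fun θ => symDet (X θ) := continuous_symDet.comp hX
  have i : ∀ f : ℝ → ℝ, Continuous f →
      IntervalIntegrable f MeasureTheory.volume 0 (2 * Real.pi) :=
    fun f hf => hf.intervalIntegrable _ _
  set c := gapIntegral X m
  set J := ∫ θ in (0 : ℝ)..(2 * Real.pi), -2 * symDet (X θ) / symGap m (X θ) with hJ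
  have hE : ∫ θ in (0 : ℝ)..(2 * Real.pi), -4 * √(symDet m) * symDet (X θ) / symGap m (X θ) =
      2 * √(symDet m) * J := by
    rw [hJ, ← intervalIntegral.integral_const_mul]
    exact intervalIntegral.integral_congr fun θ _ => by ring
  rw [hE] at heq
  simp only [hE] at hge
  set I₁ := ∫ θ in (0 : ℝ)..(2 * Real.pi), symPair m (X θ) * (X θ).1 / symGap m (X θ) with hI₁
  set I₂ := ∫ θ in (0 : ℝ)..(2 * Real.pi), symPair m (X θ) * (X θ).2.1 / symGap m (X θ) with hI₂
  set I₃ := ∫ θ in (0 : ℝ)..(2 * Real.pi), symPair m (X θ) * (X θ).2.2 / symGap m (X θ) with hI₃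
  have hs : 0 < √(symDet m) := Real.sqrt_pos.2 hd
  -- Lagrange condition in direction `v`. The gradient of `√det` at `m` is `adj m / (2 √(det m))`,
  -- whose denominator cancels the factor `2 √(det m)` in front of `J`.
  have key : ∀ v : ℝ × ℝ × ℝ, c * symPair v ρ - symPair v (I₁, I₂, I₃) =
      J * (m.1 * v.2.2 + m.2.2 * v.1 - 2 * m.2.1 * v.2.1) := by
    intro v
    have hxz : 0 < m.1 * m.2.2 := by unfold symDet at hd; nlinarith [sq_nonneg m.2.1]
    have ev : ∀ᶠ s in nhds (0 : ℝ), SymPSD (m + s • v) := by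
      have g : ∀ {f : ℝ → ℝ}, Continuous f → 0 < f 0 → ∀ᶠ s in nhds (0 : ℝ), 0 < f s :=
        fun hf h => hf.continuousAt.eventually (lt_mem_nhds h)
      have e1 := g (f := fun s => (m + s • v).1) (by fun_prop)
        (by simpa using pos_of_mul_pos_left hxz hm.2.1)
      have e2 := g (f := fun s => (m + s • v).2.2) (by fun_prop)
        (by simpa using pos_of_mul_pos_right hxz hm.1)
      have e3 := g (f := fun s => symDet (m + s • v)) (continuous_symDet.comp (by fun_prop))
        (by simpa using hd)
      filter_upwards [e1, e2, e3] with s a1 a2 a3 using ⟨a1.le, a2.le, a3.le⟩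
    have := eq_of_sqrt_tangent_le (a := c * symPair v ρ - symPair v (I₁, I₂, I₃))
      (b := m.1 * v.2.2 + m.2.2 * v.1 - 2 * m.2.1 * v.2.1) (e := symDet v)
      (E := 2 * √(symDet m) * J) hd (by
        filter_upwards [ev] with s hps
        have a := (hge _ hps.2.2).trans (hmax _ hps)
        have b1 : symDet (m + s • v) = symDet m +
            s * (m.1 * v.2.2 + m.2.2 * v.1 - 2 * m.2.1 * v.2.1) + s ^ 2 * symDet v := by
          simp only [symDet, Prod.fst_add, Prod.snd_add, Prod.smul_fst, Prod.smul_snd,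
            smul_eq_mul]
          ring
        have b2 : ∀ k, symPair (m + s • v) k = symPair m k + s * symPair v k := by
          intro k
          simp only [symPair, Prod.fst_add, Prod.snd_add, Prod.smul_fst, Prod.smul_snd,
            smul_eq_mul]
          ring
        rw [b1, b2, b2, h1] at a
        linarith)
    rw [this]
    field_simp
  have k1 := key (1, 0, 0)
  have k2 := key (0, 1, 0)
  have k3 := key (0, 0, 1)
  simp only [symPair] at k1 k2 k3
  refine ⟨?_, ?_, ?_⟩
  · have : c * ρ.1 = I₁ + J * m.2.2 := by linarith
    rw [this, hI₁, hJ, ← intervalIntegral.integral_mul_const, ← intervalIntegral.integral_add]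
    · exact intervalIntegral.integral_congr fun θ _ => by ring
    all_goals exact i _ (by fun_prop (disch := assumption))
  · have : c * ρ.2.1 = I₂ + J * -m.2.1 := by linarith
    rw [this, hI₂, hJ, ← intervalIntegral.integral_mul_const, ← intervalIntegral.integral_add]
    · exact intervalIntegral.integral_congr fun θ _ => by ring
    all_goals exact i _ (by fun_prop (disch := assumption))
  · have : c * ρ.2.2 = I₃ + J * m.1 := by linarith
    rw [this, hI₃, hJ, ← intervalIntegral.integral_mul_const, ← intervalIntegral.integral_add]
    · exact intervalIntegral.integral_congr fun θ _ => by ring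
    all_goals exact i _ (by fun_prop (disch := assumption))

/-! ### Maximisers are nonsingular: the logarithmic gain. -/

theorem integral_inv_affine (a : ℝ) {α β : ℝ} (hα : 0 < α) (hβ : 0 < β) :
    ∫ θ in a..(a + 1), (α * (θ - a) + β)⁻¹ = α⁻¹ * Real.log ((α + β) / β) := by
  have hp : ∀ θ ∈ Set.uIcc a (a + 1), α * (θ - a) + β ≠ 0 := by
    intro θ hθ
    rw [Set.uIcc_of_le (by linarith)] at hθ
    have := mul_nonneg hα.le (sub_nonneg.2 hθ.1)
    positivity
  have hd : ∀ θ ∈ Set.uIcc a (a + 1), HasDerivAt (fun θ => α⁻¹ * Real.log (α * (θ - a) + β))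
      ((α * (θ - a) + β)⁻¹) θ := by
    intro θ hθ
    refine ((((((hasDerivAt_id θ).sub_const a).const_mul α).add_const β).log
      (hp θ hθ)).const_mul α⁻¹).congr_deriv ?_
    simp only [id_eq]
    field_simp
  rw [intervalIntegral.integral_eq_sub_of_hasDerivAt hd]
  · rw [Real.log_div (by positivity) hβ.ne']
    simp
    ring
  · refine ContinuousOn.intervalIntegrable ?_
    exact ContinuousOn.inv₀ (by fun_prop) hp

/-- Rationalise to `b / (√(a² + b) + |a|)` and use `√(a² + b) ≤ |a| + √b`. -/
theorem div_le_sqrt_sub_abs {a b : ℝ} (hb : 0 < b) : b / (2 * |a| + √b) ≤ √(a ^ 2 + b) - |a| := by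
  have hs : 0 < √b := Real.sqrt_pos.2 hb
  have h2 := Real.sq_sqrt hb.le
  have h1 : √(a ^ 2 + b) ^ 2 = a ^ 2 + b := Real.sq_sqrt (by positivity)
  have h3 : √(a ^ 2 + b) ≤ |a| + √b := by
    rw [Real.sqrt_le_left (by positivity)]
    nlinarith [sq_abs a, mul_nonneg (abs_nonneg a) hs.le]
  have h4 : |a| ≤ √(a ^ 2 + b) := Real.abs_le_sqrt (by linarith)
  rw [div_le_iff₀ (by positivity)]
  nlinarith [sq_abs a, mul_nonneg (sub_nonneg.2 h4) (sub_nonneg.2 h3)]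

/-- A maximum of `gapIntegral X` on the slice `symPair m ρ = 1` lies in the interior of the
cone. -/
theorem symDet_pos_of_gapIntegral_max {X : ℝ → ℝ × ℝ × ℝ} (hX : Continuous X)
    (hlip : ∀ m, ∃ L, ∀ s t, |symPair m (X s) - symPair m (X t)| ≤ L * |s - t|)
    (hanti : ∀ θ, X (θ + Real.pi) = -X θ)
    (hneg : ∀ θ, symDet (X θ) < 0) {m ρ : ℝ × ℝ × ℝ} (h0 : 0 < ρ.1) (hd : 0 < symDet ρ)
    (hm : SymPSD m) (h1 : symPair m ρ = 1)
    (hmax : ∀ n, SymPSD n → gapIntegral X n ≤ gapIntegral X m * symPair n ρ) :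
    0 < symDet m := by
  by_contra hcon
  have hm0 : symDet m = 0 := le_antisymm (not_lt.1 hcon) hm.2.2
  have hpi := Real.pi_gt_three
  -- Antiperiodicity gives `Tr (m X)` opposite values at `0` and `π`.
  obtain ⟨θ₀, ⟨hθ0, hθπ⟩, hzero⟩ : ∃ θ ∈ Set.Icc 0 Real.pi, symPair m (X θ) = 0 := by
    have hc := (continuous_symPair_comp hX m).continuousOn (s := Set.uIcc 0 Real.pi)
    have hπ : symPair m (X Real.pi) = -symPair m (X 0) := by
      have := hanti 0
      rw [zero_add] at this
      rw [this]; simp only [symPair, Prod.fst_neg, Prod.snd_neg]; ring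
    have := intermediate_value_uIcc hc
    rw [Set.uIcc_of_le (a := 0) (b := Real.pi) (by positivity)] at this
    refine this ?_
    simp only [hπ]
    rw [Set.mem_uIcc]
    rcases le_total 0 (symPair m (X 0)) with h | h
    · right; constructor <;> linarith
    · left; constructor <;> linarith
  obtain ⟨L, hL, hlipm⟩ : ∃ L > 0, ∀ s t, |symPair m (X s) - symPair m (X t)| ≤ L * |s - t| := by
    obtain ⟨L, hL⟩ := hlip m
    refine ⟨max L 1, by positivity, fun s t => (hL s t).trans ?_⟩
    gcongr
    exact le_max_left _ _
  have hI : Set.Nonempty (Set.Icc 0 (2 * Real.pi)) := ⟨0, by constructor <;> linarith⟩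
  obtain ⟨δ, hδ, hδX⟩ : ∃ δ > 0, ∀ θ ∈ Set.Icc 0 (2 * Real.pi),
      δ ≤ -symDet (X θ) / symDet ρ := by
    obtain ⟨θ, _, hθ⟩ := isCompact_Icc.exists_isMinOn hI
      ((continuous_symDet.comp hX).neg.div_const (symDet ρ)).continuousOn
    exact ⟨_, div_pos (neg_pos.2 (hneg θ)) hd, fun t ht => hθ ht⟩
  obtain ⟨B, hB, hBX⟩ : ∃ B > 0, ∀ θ ∈ Set.Icc 0 (2 * Real.pi),
      |symPair (symCenter ρ) (X θ) - symPair m (X θ)| ≤ B := by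
    obtain ⟨B, hB⟩ := (isCompact_Icc (a := 0) (b := 2 * Real.pi)).exists_bound_of_continuousOn
      ((continuous_symPair_comp hX (symCenter ρ)).sub
        (continuous_symPair_comp hX m)).continuousOn
    exact ⟨max B 1, by positivity, fun θ hθ => (hB θ hθ).trans (le_max_left _ _)⟩
  have hsδ : 0 < √δ := Real.sqrt_pos.2 hδ
  set K := 2 * B + √δ with hK
  have hKpos : 0 < K := by positivity
  -- The right side does not depend on `η`, while the logarithm diverges as `η → 0`. The
  -- perturbation has size `ε = η²`, so that `√(εδ)` and `εB` are both bounded by multiples of `η`,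
  -- collected in `K`.
  have main : ∀ η, 0 < η → η ≤ 1 →
      δ * ((2 * L)⁻¹ * Real.log ((2 * L + K * η) / (K * η))) ≤ 2 * Real.pi * B := by
    intro η hη hη1
    set ε := η ^ 2 with hε
    have hεp : 0 < ε := by positivity
    have hε1 : ε ≤ 1 := by rw [hε]; nlinarith
    have hεη : ε ≤ η := by rw [hε]; nlinarith
    set n := (1 - ε) • m + ε • symCenter ρ with hn
    have hpair : ∀ k, symPair n k =
        symPair m k + ε * (symPair (symCenter ρ) k - symPair m k) := by
      intro k
      simp only [hn, symPair, Prod.fst_add, Prod.snd_add, Prod.smul_fst, Prod.smul_snd,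
        smul_eq_mul]
      ring
    -- Since `symCenter ρ` is `ρ⁻¹ / 2`, the mixed term of the determinant is a multiple of `Tr (m
    -- ρ) = 1`. So `det n` is of first order in `ε`, although `det m = 0`.
    have hdet : symDet n = (2 * ε - ε ^ 2) / (4 * symDet ρ) := by
      have hd' := hd.ne'
      have : symDet n = (1 - ε) ^ 2 * symDet m +
          ε * (1 - ε) * (2 * symDet ρ)⁻¹ * symPair m ρ +
          ε ^ 2 * ((2 * symDet ρ)⁻¹ ^ 2 * symDet ρ) := by
        simp only [hn, symCenter]
        generalize (2 * symDet ρ)⁻¹ = k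
        simp only [symDet, symPair, Prod.fst_add, Prod.snd_add, Prod.smul_fst, Prod.smul_snd,
          smul_eq_mul]
        ring
      rw [this, hm0, h1]
      field_simp
      ring
    have hcen := symPSD_symCenter h0 hd
    have hnp : SymPSD n := by
      refine ⟨?_, ?_, ?_⟩
      · exact add_nonneg (mul_nonneg (by linarith) hm.1) (mul_nonneg hεp.le hcen.1)
      · exact add_nonneg (mul_nonneg (by linarith) hm.2.1) (mul_nonneg hεp.le hcen.2.1)
      · rw [hdet]
        have : 0 ≤ 2 * ε - ε ^ 2 := by nlinarith
        positivity
    have hle := hmax n hnp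
    rw [hpair, symPair_symCenter hd, h1, sub_self, mul_zero, add_zero, mul_one] at hle
    have hgap : ∀ θ, symGap m (X θ) = |symPair m (X θ)| := fun θ => by
      rw [symGap, hm0, mul_zero, zero_mul, sub_zero, Real.sqrt_sq_eq_abs]
    have hclose : ∀ θ ∈ Set.Icc 0 (2 * Real.pi),
        |symPair n (X θ) - symPair m (X θ)| ≤ ε * B := by
      intro θ hθ
      rw [hpair, add_sub_cancel_left, abs_mul, abs_of_pos hεp]
      exact mul_le_mul_of_nonneg_left (hBX θ hθ) hεp.le
    have hlow : ∀ θ ∈ Set.Icc 0 (2 * Real.pi),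
        √(symPair n (X θ) ^ 2 + ε * δ) ≤ symGap n (X θ) := by
      intro θ hθ
      apply Real.sqrt_le_sqrt
      rw [hdet]
      have e : 4 * ((2 * ε - ε ^ 2) / (4 * symDet ρ)) * symDet (X θ) =
          -((2 * ε - ε ^ 2) * (-symDet (X θ) / symDet ρ)) := by field_simp
      rw [e]
      have : ε * δ ≤ (2 * ε - ε ^ 2) * (-symDet (X θ) / symDet ρ) :=
        mul_le_mul (by nlinarith) (hδX θ hθ) hδ.le (by nlinarith)
      linarith
    have hεδ : 0 < ε * δ := by positivity
    have hpt : ∀ θ ∈ Set.Icc 0 (2 * Real.pi), ε * δ / (2 * |symPair n (X θ)| + √(ε * δ)) ≤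
        symGap n (X θ) - symGap m (X θ) + ε * B := by
      intro θ hθ
      have a1 := hlow θ hθ
      have a2 := div_le_sqrt_sub_abs (a := symPair n (X θ)) hεδ
      have a3 := hclose θ hθ
      have a4 := abs_sub_abs_le_abs_sub (symPair m (X θ)) (symPair n (X θ))
      rw [abs_sub_comm] at a4
      rw [hgap]
      linarith
    have cn := continuous_symGap_comp hX n
    have cm := continuous_symGap_comp hX m
    have cF : Continuous fun θ => symGap n (X θ) - symGap m (X θ) + ε * B := by fun_prop
    have htot : ∫ θ in (0 : ℝ)..(2 * Real.pi), (symGap n (X θ) - symGap m (X θ) + ε * B) ≤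
        2 * Real.pi * (ε * B) := by
      have ci : IntervalIntegrable (fun θ => symGap n (X θ) - symGap m (X θ))
          MeasureTheory.volume 0 (2 * Real.pi) := (cn.sub cm).intervalIntegrable _ _
      rw [intervalIntegral.integral_add ci (continuous_const.intervalIntegrable _ _),
        intervalIntegral.integral_sub (cn.intervalIntegrable _ _) (cm.intervalIntegrable _ _),
        intervalIntegral.integral_const]
      simp only [gapIntegral] at hle
      simp only [sub_zero, smul_eq_mul]
      linarith
    -- The unit interval to the right of the zero stays inside `[0, 2π]` because `θ₀ ≤ π` and `π >
    -- 3`; the integrand is nonnegative by `hpt`.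
    have hsub : ∫ θ in θ₀..(θ₀ + 1), (symGap n (X θ) - symGap m (X θ) + ε * B) ≤
        ∫ θ in (0 : ℝ)..(2 * Real.pi), (symGap n (X θ) - symGap m (X θ) + ε * B) := by
      refine intervalIntegral.integral_mono_interval hθ0 (by linarith) (by linarith) ?_
        (cF.intervalIntegrable _ _)
      refine (MeasureTheory.ae_restrict_iff' measurableSet_Ioc).2 (Filter.Eventually.of_forall ?_)
      intro θ hθ
      exact (by positivity : (0 : ℝ) ≤ _).trans (hpt θ ⟨hθ.1.le, hθ.2⟩)
    have hlog : ∫ θ in θ₀..(θ₀ + 1), ε * δ * (2 * L * (θ - θ₀) + K * η)⁻¹ ≤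
        ∫ θ in θ₀..(θ₀ + 1), (symGap n (X θ) - symGap m (X θ) + ε * B) := by
      refine intervalIntegral.integral_mono_on (by linarith) ?_ (cF.intervalIntegrable _ _) ?_
      · refine ContinuousOn.intervalIntegrable ?_
        refine continuousOn_const.mul (ContinuousOn.inv₀ (by fun_prop) ?_)
        intro θ hθ
        rw [Set.uIcc_of_le (by linarith)] at hθ
        have := mul_nonneg (mul_pos two_pos hL).le (sub_nonneg.2 hθ.1)
        positivity
      · intro θ hθ
        have hθ' : θ ∈ Set.Icc 0 (2 * Real.pi) := ⟨hθ0.trans hθ.1, by linarith [hθ.2]⟩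
        refine le_trans ?_ (hpt θ hθ')
        rw [div_eq_mul_inv]
        have b1 := hclose θ hθ'
        have b2 := hlipm θ θ₀
        rw [hzero, sub_zero, abs_of_nonneg (sub_nonneg.2 hθ.1)] at b2
        have b3 := abs_sub_abs_le_abs_sub (symPair n (X θ)) (symPair m (X θ))
        have b4 : √(ε * δ) = η * √δ := by
          rw [Real.sqrt_mul hεp.le, hε, Real.sqrt_sq hη.le]
        have b5 : ε * B ≤ η * B := mul_le_mul_of_nonneg_right hεη hB.le
        have b6 : 0 < √(ε * δ) := Real.sqrt_pos.2 hεδ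
        refine mul_le_mul_of_nonneg_left (inv_anti₀ (by positivity) ?_) hεδ.le
        rw [b4, hK]
        nlinarith
    rw [intervalIntegral.integral_const_mul,
      integral_inv_affine θ₀ (by positivity) (by positivity)] at hlog
    have := (hlog.trans hsub).trans htot
    have h' : ε * (δ * ((2 * L)⁻¹ * Real.log ((2 * L + K * η) / (K * η)))) ≤
        ε * (2 * Real.pi * B) := by linarith
    exact le_of_mul_le_mul_left h' hεp
  set C := 2 * Real.pi * B / δ * (2 * L) with hC
  have hlog : ∀ η, 0 < η → η ≤ 1 → 2 * L ≤ K * η * Real.exp C := by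
    intro η hη hη1
    have a := main η hη hη1
    have b : Real.log ((2 * L + K * η) / (K * η)) ≤ C := by
      rw [hC, ← div_le_iff₀ (by positivity), le_div_iff₀ hδ]
      calc _ = δ * ((2 * L)⁻¹ * Real.log ((2 * L + K * η) / (K * η))) := by
            rw [div_eq_mul_inv]; ring
        _ ≤ _ := a
    rw [Real.log_le_iff_le_exp (by positivity), div_le_iff₀ (by positivity)] at b
    nlinarith [mul_pos hKpos hη]
  -- This `η` makes `K η exp C ≤ L`, against the bound `2 L ≤ K η exp C`.
  have hfin := hlog (min 1 (L / (K * Real.exp C))) (by positivity) (min_le_left _ _)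
  have : K * min 1 (L / (K * Real.exp C)) * Real.exp C ≤ L := by
    calc _ = K * Real.exp C * min 1 (L / (K * Real.exp C)) := by ring
      _ ≤ K * Real.exp C * (L / (K * Real.exp C)) := by gcongr; exact min_le_right _ _
      _ = L := by field_simp
  linarith

/-- The equation `∫ |X|_Y = c ρ` in coordinates, with `m = Y²`. -/
theorem exists_critical {X : ℝ → ℝ × ℝ × ℝ} (hX : Continuous X)
    (hlip : ∀ m, ∃ L, ∀ s t, |symPair m (X s) - symPair m (X t)| ≤ L * |s - t|)
    (hanti : ∀ θ, X (θ + Real.pi) = -X θ)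
    (hneg : ∀ θ, symDet (X θ) < 0) {ρ : ℝ × ℝ × ℝ} (h0 : 0 < ρ.1) (hd : 0 < symDet ρ) :
    ∃ (m : ℝ × ℝ × ℝ) (c : ℝ), 0 < m.1 ∧ 0 < m.2.2 ∧ 0 < symDet m ∧
    ∫ θ in (0 : ℝ)..(2 * Real.pi),
        (symPair m (X θ) * (X θ).1 - 2 * symDet (X θ) * m.2.2) / symGap m (X θ) = c * ρ.1 ∧
    ∫ θ in (0 : ℝ)..(2 * Real.pi),
        (symPair m (X θ) * (X θ).2.1 + 2 * symDet (X θ) * m.2.1) / symGap m (X θ) = c * ρ.2.1 ∧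
    ∫ θ in (0 : ℝ)..(2 * Real.pi),
        (symPair m (X θ) * (X θ).2.2 - 2 * symDet (X θ) * m.1) / symGap m (X θ) = c * ρ.2.2 := by
  obtain ⟨m, hm, h1, hmax⟩ := exists_gapIntegral_max hX h0 hd
  have hdm := symDet_pos_of_gapIntegral_max hX hlip hanti hneg h0 hd hm h1 hmax
  have hxz : 0 < m.1 * m.2.2 := by unfold symDet at hdm; nlinarith [sq_nonneg m.2.1]
  exact ⟨m, gapIntegral X m, pos_of_mul_pos_left hxz hm.2.1, pos_of_mul_pos_right hxz hm.1, hdm,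
    critical_of_gapIntegral_max hX hneg hm hdm h1 hmax⟩

/-! ### The relative absolute value in closed form. -/

/-- The real symmetric matrix with upper triangular entries `m`. -/
def symMat : ℝ × ℝ × ℝ →ₗ[ℝ] Matrix (Fin 2) (Fin 2) ℂ where
  toFun m := !![(m.1 : ℂ), m.2.1; m.2.1, m.2.2]
  map_add' m n := by ext i j; fin_cases i <;> fin_cases j <;> simp
  map_smul' c m := by ext i j; fin_cases i <;> fin_cases j <;> simp

theorem symMat_apply (m : ℝ × ℝ × ℝ) : symMat m = !![(m.1 : ℂ), m.2.1; m.2.1, m.2.2] := rfl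

theorem isRealMatrix_symMat (m : ℝ × ℝ × ℝ) : IsRealMatrix (symMat m) := by
  intro i j
  fin_cases i <;> fin_cases j <;> simp [symMat_apply]

theorem isHermitian_symMat (m : ℝ × ℝ × ℝ) : (symMat m).IsHermitian := by
  ext i j
  fin_cases i <;> fin_cases j <;> simp [symMat_apply]

theorem det_symMat (m : ℝ × ℝ × ℝ) : (symMat m).det = (symDet m : ℂ) := by
  simp [symMat_apply, symDet, Matrix.det_fin_two, sq]

theorem star_dotProduct_symMat_mulVec (m : ℝ × ℝ × ℝ) (v : Fin 2 → ℂ) :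
    star v ⬝ᵥ (symMat m).mulVec v = ((m.1 * ((v 0).re ^ 2 + (v 0).im ^ 2) +
      2 * m.2.1 * ((v 0).re * (v 1).re + (v 0).im * (v 1).im) +
      m.2.2 * ((v 1).re ^ 2 + (v 1).im ^ 2) : ℝ) : ℂ) := by
  apply Complex.ext <;>
    simp [symMat_apply, dotProduct, Matrix.mulVec, Fin.sum_univ_two, pow_two] <;> ring

theorem posDef_symMat {m : ℝ × ℝ × ℝ} (h0 : 0 < m.1) (hd : 0 < symDet m) :
    (symMat m).PosDef := by
  refine Matrix.PosDef.of_dotProduct_mulVec_pos (isHermitian_symMat m) fun v hv => ?_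
  rw [star_dotProduct_symMat_mulVec]
  rw [Complex.zero_lt_real]
  have hne : 0 < (v 0).re ^ 2 + (v 0).im ^ 2 ∨ 0 < (v 1).re ^ 2 + (v 1).im ^ 2 := by
    by_contra! h
    apply hv
    ext i
    fin_cases i
    · have := h.1
      exact Complex.ext (by simp; nlinarith) (by simp; nlinarith)
    · have := h.2
      exact Complex.ext (by simp; nlinarith) (by simp; nlinarith)
  refine pos_of_mul_pos_right (a := m.1) ?_ h0.le
  simp only [symDet] at hd
  set a := v 0
  set b := v 1
  have e : m.1 * (m.1 * (a.re ^ 2 + a.im ^ 2) + 2 * m.2.1 * (a.re * b.re + a.im * b.im) +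
      m.2.2 * (b.re ^ 2 + b.im ^ 2)) = (m.1 * a.re + m.2.1 * b.re) ^ 2 +
      (m.1 * a.im + m.2.1 * b.im) ^ 2 +
      (m.1 * m.2.2 - m.2.1 ^ 2) * (b.re ^ 2 + b.im ^ 2) := by ring
  rw [e]
  rcases (by positivity : 0 ≤ b.re ^ 2 + b.im ^ 2).eq_or_lt with h | h
  · have h1 : b.re = 0 := by nlinarith
    have h2 : b.im = 0 := by nlinarith
    rw [h1, h2] at hne ⊢
    simp only [mul_zero, add_zero, ne_eq, OfNat.ofNat_ne_zero, not_false_eq_true, zero_pow,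
      lt_self_iff_false, or_false] at hne ⊢
    rw [mul_pow, mul_pow, ← mul_add]
    positivity
  · have := mul_pos hd h
    positivity

theorem posSemidef_symMat {m : ℝ × ℝ × ℝ} (hm : SymPSD m) : (symMat m).PosSemidef := by
  refine Matrix.PosSemidef.of_dotProduct_mulVec_nonneg (isHermitian_symMat m) fun v => ?_
  rw [star_dotProduct_symMat_mulVec, Complex.zero_le_real]
  have h := symPair_nonneg hm (k := ((v 0).re ^ 2, (v 0).re * (v 1).re, (v 1).re ^ 2))
    ⟨sq_nonneg _, sq_nonneg _, by simp only [symDet]; nlinarith⟩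
  have h' := symPair_nonneg hm (k := ((v 0).im ^ 2, (v 0).im * (v 1).im, (v 1).im ^ 2))
    ⟨sq_nonneg _, sq_nonneg _, by simp only [symDet]; nlinarith⟩
  simp only [symPair] at h h'
  linarith

/-- The coordinates of the matrix product `a * m * a`. -/
def symSandwich (a m : ℝ × ℝ × ℝ) : ℝ × ℝ × ℝ :=
  (a.1 ^ 2 * m.1 + 2 * a.1 * a.2.1 * m.2.1 + a.2.1 ^ 2 * m.2.2,
    a.1 * a.2.1 * m.1 + (a.1 * a.2.2 + a.2.1 ^ 2) * m.2.1 + a.2.1 * a.2.2 * m.2.2,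
    a.2.1 ^ 2 * m.1 + 2 * a.2.1 * a.2.2 * m.2.1 + a.2.2 ^ 2 * m.2.2)

theorem symMat_sandwich (a m : ℝ × ℝ × ℝ) :
    symMat a * symMat m * symMat a = symMat (symSandwich a m) := by
  simp only [symMat_apply, symSandwich]
  ext i j
  fin_cases i <;> fin_cases j <;> simp [Matrix.mul_apply, Fin.sum_univ_two] <;> ring

/-- The coordinates of the absolute value of `k` relative to `Y`, where `m` is a positive multiple
of `Y ^ 2`. -/
noncomputable def symAbs (m k : ℝ × ℝ × ℝ) : ℝ × ℝ × ℝ :=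
  ((symPair m k * k.1 - 2 * symDet k * m.2.2) / symGap m k,
    (symPair m k * k.2.1 + 2 * symDet k * m.2.1) / symGap m k,
    (symPair m k * k.2.2 - 2 * symDet k * m.1) / symGap m k)

theorem symAbs_smul {c : ℝ} (hc : 0 < c) (m k : ℝ × ℝ × ℝ) : symAbs (c • m) k = symAbs m k := by
  have hp : symPair (c • m) k = c * symPair m k := by
    simp only [symPair, Prod.smul_fst, Prod.smul_snd, smul_eq_mul]; ring
  simp only [symAbs, symGap_smul hc.le, hp, Prod.smul_fst, Prod.smul_snd, smul_eq_mul]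
  refine Prod.ext ?_ (Prod.ext ?_ ?_) <;> refine Eq.trans ?_ (mul_div_mul_left _ _ hc.ne') <;> ring

theorem sq_symGap {m k : ℝ × ℝ × ℝ} (hm : 0 ≤ symDet m) (hk : symDet k ≤ 0) :
    symGap m k ^ 2 = symPair m k ^ 2 - 4 * symDet m * symDet k :=
  Real.sq_sqrt (by nlinarith [sq_nonneg (symPair m k), mul_nonneg hm (neg_nonneg.2 hk)])

theorem symPSD_symAbs {m k : ℝ × ℝ × ℝ} (hm : SymPSD m) (hd : 0 < symDet m) (hk : symDet k < 0) :
    SymPSD (symAbs m k) := by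
  have hg := symGap_pos hd hk
  have hsq := sq_symGap hd.le hk.le
  refine ⟨div_nonneg ?_ hg.le, div_nonneg ?_ hg.le, ?_⟩
  -- The numerator is `Tr (m r rᵀ) - det k · m.2.2`, with `r` the first row of `k`; the other
  -- diagonal entry uses the second row.
  · have h1 := symPair_nonneg hm (k := (k.1 ^ 2, k.1 * k.2.1, k.2.1 ^ 2))
      ⟨sq_nonneg _, sq_nonneg _, by simp only [symDet]; nlinarith⟩
    have h2 := mul_nonneg (neg_pos.2 hk).le hm.2.1
    simp only [symPair, symDet] at *
    nlinarith
  · have h1 := symPair_nonneg hm (k := (k.2.1 ^ 2, k.2.1 * k.2.2, k.2.2 ^ 2))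
      ⟨sq_nonneg _, sq_nonneg _, by simp only [symDet]; nlinarith⟩
    have h2 := mul_nonneg (neg_pos.2 hk).le hm.1
    simp only [symPair, symDet] at *
    nlinarith
  · have : symDet (symAbs m k) = -symDet k * symGap m k ^ 2 / symGap m k ^ 2 := by
      rw [hsq, ← hsq]
      simp only [symAbs]
      rw [symDet]
      field_simp
      rw [hsq]
      simp only [symPair, symDet]
      ring
    rw [this, mul_div_cancel_right₀ _ (by positivity)]
    linarith

/-- With `A = symAbs m k` this is `A m A = k m k`, which for `m = Y²` amounts to `(Y A Y)² = (Y k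
Y)²`. -/
theorem symSandwich_symAbs {m k : ℝ × ℝ × ℝ} (hd : 0 < symDet m) (hk : symDet k < 0) :
    symSandwich (symAbs m k) m = symSandwich k m := by
  have hg := symGap_pos hd hk
  have hsq := sq_symGap hd.le hk.le
  simp only [symSandwich, symAbs]
  refine Prod.ext ?_ (Prod.ext ?_ ?_)
  all_goals
    simp only
    field_simp
    rw [hsq]
    simp only [symPair, symDet]
    ring

/-- A symmetric `Z` with eigenvalues `λ > 0 > μ` has `|Z| = (Tr Z · Z - 2 det Z) / (λ - μ)`. For `Z
= Y k Y`, conjugating by `Y⁻¹` turns `det Z` into `det k · adj (Y²)`, which is the source of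
`symAbs`. The proof checks the square and the positivity, then uses uniqueness of the positive
square root. -/
theorem absRel_symMat {y m k : ℝ × ℝ × ℝ} {c : ℝ} (hc : 0 < c) (hm : SymPSD m)
    (hd : 0 < symDet m) (hy : symMat y * symMat y = symMat (c • m)) (hk : symDet k < 0) :
    absRel (symMat y) (symMat k) = symMat (symAbs m k) := by
  have hcd : symDet (c • m) = c ^ 2 * symDet m := by
    simp only [symDet, Prod.smul_fst, Prod.smul_snd, smul_eq_mul]; ring
  have hd' : 0 < symDet (c • m) := by rw [hcd]; positivity
  have hm' := hm.smul hc.le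
  have hu : IsUnit (symMat y).det := by
    have h := congrArg Matrix.det hy
    rw [Matrix.det_mul, det_symMat (c • m)] at h
    refine isUnit_iff_ne_zero.2 fun h0 => ?_
    rw [h0, mul_zero] at h
    exact hd'.ne (by exact_mod_cast h)
  rw [← symAbs_smul hc]
  set n := c • m
  set Y := symMat y with hY
  set K := symMat k with hK
  set A := symMat (symAbs n k) with hA
  have hYs : star Y = Y := isHermitian_symMat y
  have hKs : star K = K := isHermitian_symMat k
  have habs : CFC.abs (Y * K * Y) = Y * A * Y := by
    rw [CFC.abs]
    refine CFC.sqrt_unique ?_ ?_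
    · rw [star_mul, star_mul, hYs, hKs]
      have e := symMat_sandwich (symAbs n k) n
      rw [symSandwich_symAbs hd' hk, ← symMat_sandwich, ← hy] at e
      calc Y * A * Y * (Y * A * Y) = Y * (A * (Y * Y) * A) * Y := by noncomm_ring
        _ = Y * (K * (Y * Y) * K) * Y := by rw [e]
        _ = _ := by noncomm_ring
    · rw [Matrix.nonneg_iff_posSemidef]
      have := (posSemidef_symMat (symPSD_symAbs hm' hd' hk)).conjTranspose_mul_mul_same Y
      rwa [← Matrix.star_eq_conjTranspose, hYs] at this
  rw [absRel, habs, Matrix.mul_assoc Y, Matrix.nonsing_inv_mul_cancel_left _ _ hu,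
    Matrix.mul_nonsing_inv_cancel_right _ _ hu]

/-- Up to a positive factor, a positive definite real symmetric matrix is the square of a positive
definite real density matrix. -/
theorem exists_density_sq {m : ℝ × ℝ × ℝ} (h0 : 0 < m.1) (h2 : 0 < m.2.2) (hd : 0 < symDet m) :
    ∃ (y : ℝ × ℝ × ℝ) (c : ℝ), 0 < c ∧ symMat y * symMat y = symMat (c • m) ∧
      IsPosDefRealDensity (symMat y) := by
  set s := √(symDet m) with hs
  have hsp : 0 < s := Real.sqrt_pos.2 hd
  have hsq : s ^ 2 = m.1 * m.2.2 - m.2.1 ^ 2 := Real.sq_sqrt hd.le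
  set k := m.1 + m.2.2 + 2 * s with hk
  have hkp : 0 < k := by positivity
  -- By Cayley–Hamilton, `(m + s)² = (Tr m + 2 s) m = k m` when `s² = det m`. Since `k` is also the
  -- trace of `m + s`, division by `k` gives trace one and square `m / k`.
  refine ⟨((m.1 + s) / k, m.2.1 / k, (m.2.2 + s) / k), 1 / k, by positivity, ?_,
    isRealMatrix_symMat _, posDef_symMat (by simp only; positivity) ?_, ?_⟩
  · have := symMat_sandwich ((m.1 + s) / k, m.2.1 / k, (m.2.2 + s) / k) (1, 0, 1)
    have h1 : symMat (1, 0, 1) = 1 := by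
      ext i j; fin_cases i <;> fin_cases j <;> simp [symMat_apply]
    rw [h1, mul_one] at this
    rw [this]
    congr 1
    simp only [symSandwich]
    refine Prod.ext ?_ (Prod.ext ?_ ?_)
    all_goals
      simp only [Prod.smul_fst, Prod.smul_snd, smul_eq_mul]
      field_simp
      rw [hk]
      first | ring1 | linear_combination hsq
  · simp only [symDet]
    have : (m.1 + s) / k * ((m.2.2 + s) / k) - (m.2.1 / k) ^ 2 = s / k := by
      field_simp
      rw [hk]
      linear_combination -hsq
    rw [this]
    positivity
  · rw [Matrix.trace_fin_two]
    simp only [symMat_apply, Matrix.of_apply, Matrix.cons_val_zero, Matrix.cons_val_one]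
    rw [← Complex.ofReal_add, ← add_div,
      show m.1 + s + (m.2.2 + s) = k by rw [hk]; ring, div_self hkp.ne', Complex.ofReal_one]

/-! ### The steering ellipse and its derivative in coordinates. -/

/-- The coordinates of `ρ_B`. -/
def reducedCoord (ρ : Matrix (Fin 2 × Fin 2) (Fin 2 × Fin 2) ℂ) : ℝ × ℝ × ℝ :=
  ((reducedB ρ 0 0).re, (reducedB ρ 0 1).re, (reducedB ρ 1 1).re)

/-- The coordinates of `Tr_A ((σ₃ ⊗ 𝕀) ρ)`. -/
def cosCoord (ρ : Matrix (Fin 2 × Fin 2) (Fin 2 × Fin 2) ℂ) : ℝ × ℝ × ℝ :=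
  ((ρ (0, 0) (0, 0) - ρ (1, 0) (1, 0)).re, (ρ (0, 0) (0, 1) - ρ (1, 0) (1, 1)).re,
    (ρ (0, 1) (0, 1) - ρ (1, 1) (1, 1)).re)

/-- The coordinates of `Tr_A ((σ₁ ⊗ 𝕀) ρ)`. -/
def sinCoord (ρ : Matrix (Fin 2 × Fin 2) (Fin 2 × Fin 2) ℂ) : ℝ × ℝ × ℝ :=
  ((ρ (1, 0) (0, 0) + ρ (0, 0) (1, 0)).re, (ρ (1, 0) (0, 1) + ρ (0, 0) (1, 1)).re,
    (ρ (1, 1) (0, 1) + ρ (0, 1) (1, 1)).re)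

theorem IsRealDensity.exists_real {ρ : Matrix (Fin 2 × Fin 2) (Fin 2 × Fin 2) ℂ}
    (hρ : IsRealDensity ρ) : ∃ R : Fin 2 × Fin 2 → Fin 2 × Fin 2 → ℝ,
      (∀ i j, R i j = R j i) ∧ ∀ i j, ρ i j = R i j := by
  refine ⟨fun i j => (ρ i j).re, fun i j => ?_, fun i j => Complex.ext (by simp) ?_⟩
  · have := congrArg Complex.re (hρ.posSemidef.isHermitian.apply i j)
    simpa using this.symm
  · simpa using hρ.real i j

theorem reducedB_eq_symMat {ρ : Matrix (Fin 2 × Fin 2) (Fin 2 × Fin 2) ℂ}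
    (hρ : IsRealDensity ρ) : reducedB ρ = symMat (reducedCoord ρ) := by
  obtain ⟨R, hs, hR⟩ := hρ.exists_real
  ext i j
  fin_cases i <;> fin_cases j <;>
    simp [reducedB, partialTraceA, reducedCoord, symMat_apply, hR, hs (_, 1) (_, 0)]

theorem steeringEllipse_eq_symMat {ρ : Matrix (Fin 2 × Fin 2) (Fin 2 × Fin 2) ℂ}
    (hρ : IsRealDensity ρ) (θ : ℝ) : steeringEllipse ρ θ =
      symMat ((1 / 2 : ℝ) •
        (reducedCoord ρ + (Real.cos θ • cosCoord ρ + Real.sin θ • sinCoord ρ))) := by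
  obtain ⟨R, hs, hR⟩ := hρ.exists_real
  have hc : Real.cos θ = 2 * Real.cos (θ / 2) ^ 2 - 1 := by
    rw [← Real.cos_two_mul]; congr 1; ring
  have hsn : Real.sin θ = 2 * Real.sin (θ / 2) * Real.cos (θ / 2) := by
    rw [← Real.sin_two_mul]; congr 1; ring
  have h1 : Real.sin (θ / 2) ^ 2 = 1 - Real.cos (θ / 2) ^ 2 := by
    rw [← Real.sin_sq_add_cos_sq (θ / 2)]; ring
  rw [hc, hsn]
  set a := Real.cos (θ / 2)
  set b := Real.sin (θ / 2)
  have key : ∀ r : Fin 2 × Fin 2 → Fin 2 × Fin 2 → ℝ, ∀ i j,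
      ∑ k, ∑ l, ![a, b] k * ![a, b] l * r (l, i) (k, j) =
      1 / 2 * ((r (0, i) (0, j) + r (1, i) (1, j)) +
        ((2 * a ^ 2 - 1) * (r (0, i) (0, j) - r (1, i) (1, j)) +
          2 * b * a * (r (1, i) (0, j) + r (0, i) (1, j)))) := by
    intro r i j
    simp only [Fin.sum_univ_two, Matrix.cons_val_zero, Matrix.cons_val_one]
    linear_combination r (1, i) (1, j) * h1
  ext i j
  rw [steeringEllipse_apply]
  simp only [hR]
  have := congrArg (fun x : ℝ => (x : ℂ)) (key R i j)
  simp only [Complex.ofReal_sum, Complex.ofReal_mul] at this ⊢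
  rw [this]
  fin_cases i <;> fin_cases j <;>
    simp [reducedB, partialTraceA, reducedCoord, symMat_apply, cosCoord, sinCoord, hR]
  rw [hs (0, 1) (0, 0), hs (1, 1) (1, 0), hs (1, 1) (0, 0), hs (0, 1) (1, 0)]
  ring

/-- The coordinates of the derivative of the steering ellipse. -/
noncomputable def derivCoord (ρ : Matrix (Fin 2 × Fin 2) (Fin 2 × Fin 2) ℂ) (θ : ℝ) : ℝ × ℝ × ℝ :=
  (1 / 2 : ℝ) • (-Real.sin θ • cosCoord ρ + Real.cos θ • sinCoord ρ)

theorem deriv_steeringEllipse {ρ : Matrix (Fin 2 × Fin 2) (Fin 2 × Fin 2) ℂ}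
    (hρ : IsRealDensity ρ) (θ : ℝ) :
    deriv (steeringEllipse ρ) θ = symMat (derivCoord ρ θ) := by
  rw [funext (steeringEllipse_eq_symMat hρ)]
  have h : HasDerivAt (fun θ : ℝ => (1 / 2 : ℝ) •
        (reducedCoord ρ + (Real.cos θ • cosCoord ρ + Real.sin θ • sinCoord ρ)))
      (derivCoord ρ θ) θ :=
    ((((Real.hasDerivAt_cos θ).smul_const (cosCoord ρ)).add
      ((Real.hasDerivAt_sin θ).smul_const (sinCoord ρ))).const_add (reducedCoord ρ)).const_smul
        (1 / 2 : ℝ)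
  exact ((LinearMap.toContinuousLinearMap symMat).hasFDerivAt.comp_hasDerivAt θ h).deriv

/-- On an ellipse the derivative is half the chord between the points at `θ ± π/2`. So it lies in
the direction space, and it kills every vector that all points of the ellipse kill. -/
theorem symMat_derivCoord {ρ : Matrix (Fin 2 × Fin 2) (Fin 2 × Fin 2) ℂ}
    (hρ : IsRealDensity ρ) (θ : ℝ) : symMat (derivCoord ρ θ) = (1 / 2 : ℝ) •
      (steeringEllipse ρ (θ + Real.pi / 2) - steeringEllipse ρ (θ - Real.pi / 2)) := by
  rw [steeringEllipse_eq_symMat hρ, steeringEllipse_eq_symMat hρ, ← map_sub, ← map_smul]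
  congr 1
  rw [Real.cos_add_pi_div_two, Real.sin_add_pi_div_two, Real.cos_sub_pi_div_two,
    Real.sin_sub_pi_div_two, derivCoord]
  module

theorem symMat_derivCoord_mem {ρ : Matrix (Fin 2 × Fin 2) (Fin 2 × Fin 2) ℂ}
    (hρ : IsRealDensity ρ) (θ : ℝ) : symMat (derivCoord ρ θ) ∈ steeringDirection ρ := by
  rw [symMat_derivCoord hρ, steeringDirection, direction_affineSpan]
  exact Submodule.smul_mem _ _ (vsub_mem_vectorSpan ℝ ⟨_, rfl⟩ ⟨_, rfl⟩)

/-- A vanishing derivative makes the two axis vectors of the ellipse proportional to a common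
vector, so the ellipse would lie on a line. -/
theorem derivCoord_ne_zero {ρ : Matrix (Fin 2 × Fin 2) (Fin 2 × Fin 2) ℂ}
    (hρ : IsRealDensity ρ) (h2 : Module.finrank ℝ (steeringDirection ρ) = 2) (θ : ℝ) :
    derivCoord ρ θ ≠ 0 := by
  intro h0
  have hle : steeringDirection ρ ≤
      Submodule.span ℝ {symMat (Real.cos θ • cosCoord ρ + Real.sin θ • sinCoord ρ)} := by
    rw [steeringDirection, direction_affineSpan, vectorSpan_def, Submodule.span_le]
    rintro _ ⟨_, ⟨s, rfl⟩, _, ⟨t, rfl⟩, rfl⟩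
    have h1 : -Real.sin θ • cosCoord ρ + Real.cos θ • sinCoord ρ = 0 := by
      exact (smul_eq_zero.1 h0).resolve_left (by norm_num)
    have hsc := Real.sin_sq_add_cos_sq θ
    have hrot : ∀ a b : ℝ, a • cosCoord ρ + b • sinCoord ρ =
        (a * Real.cos θ + b * Real.sin θ) •
          (Real.cos θ • cosCoord ρ + Real.sin θ • sinCoord ρ) +
        (b * Real.cos θ - a * Real.sin θ) •
          (-Real.sin θ • cosCoord ρ + Real.cos θ • sinCoord ρ) := by
      intro a b
      match_scalars
      · linear_combination (-a) * hsc
      · linear_combination (-b) * hsc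
    rw [SetLike.mem_coe, Submodule.mem_span_singleton]
    refine ⟨1 / 2 * ((Real.cos s - Real.cos t) * Real.cos θ +
      (Real.sin s - Real.sin t) * Real.sin θ), ?_⟩
    change _ = steeringEllipse ρ s - steeringEllipse ρ t
    rw [steeringEllipse_eq_symMat hρ, steeringEllipse_eq_symMat hρ, ← map_sub, ← map_smul]
    congr 1
    have := hrot (Real.cos s - Real.cos t) (Real.sin s - Real.sin t)
    rw [h1, smul_zero, add_zero] at this
    rw [mul_smul, ← this]
    module
  have := Submodule.finrank_mono hle
  have h3 := finrank_span_le_card (R := ℝ)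
    {symMat (Real.cos θ • cosCoord ρ + Real.sin θ • sinCoord ρ)}
  rw [Set.toFinset_singleton, Finset.card_singleton] at h3
  omega

/-! ### Consequences of tilt below one. -/

/-- Matrices trace-orthogonal to a definite real Hermitian matrix are indefinite. -/
theorem symDet_neg_of_trace_eq_zero {H : Matrix (Fin 2) (Fin 2) ℂ} (hH : H.IsHermitian)
    (hr : IsRealMatrix H) (ht : tilt H < 1) {k : ℝ × ℝ × ℝ} (hk : k ≠ 0)
    (h0 : (H.conjTranspose * symMat k).trace = 0) : symDet k < 0 := by
  have h01 : (H 1 0).re = (H 0 1).re := by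
    have := congrArg Complex.re (hH.apply 0 1)
    simpa using this
  rw [hH.eq] at h0
  have h0' := congrArg Complex.re h0
  simp only [symMat_apply, Matrix.trace_fin_two, Matrix.mul_apply, Fin.sum_univ_two,
    Complex.add_re, Complex.mul_re, hr _ _, zero_mul, sub_zero, Complex.zero_re, Matrix.of_apply,
    Matrix.cons_val_zero, Matrix.cons_val_one, Complex.ofReal_re, h01] at h0'
  rw [tilt] at ht
  split_ifs at ht with hn
  · simp at ht
  · rw [← ENNReal.ofReal_one, ENNReal.ofReal_lt_ofReal_iff one_pos,
      div_lt_one (abs_pos.2 hn), Real.sqrt_lt' (abs_pos.2 hn), sq_abs, coordN_eq, coordOne_eq,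
      coordThree_eq, h01] at ht
    obtain ⟨p, q, r⟩ := k
    simp only [symDet] at h0' ⊢
    set a := (H 0 0).re
    set b := (H 0 1).re
    set d := (H 1 1).re
    -- `n² - r₁² - r₃² = 4 det H`, so tilt `< 1` means `det H > 0`.
    have hdet : 0 < a * d - b ^ 2 := by nlinarith
    have ha : a ≠ 0 := by rintro h; rw [h] at hdet; nlinarith [sq_nonneg b]
    -- Orthogonality `a p + 2 b q + d r = 0` eliminates `p`, leaving a positive definite form in
    -- `(q, r)`.
    have e : a ^ 2 * (q ^ 2 - p * r) = (a * q + b * r) ^ 2 + (a * d - b ^ 2) * r ^ 2 := by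
      linear_combination (-a * r) * h0'
    have hpos : 0 < a ^ 2 * (q ^ 2 - p * r) := by
      rw [e]
      by_contra! hle
      have hr0 : r = 0 := by
        by_contra hr0
        have : 0 < (a * d - b ^ 2) * r ^ 2 := by positivity
        nlinarith [sq_nonneg (a * q + b * r)]
      subst hr0
      have hq0 : a * q = 0 := by nlinarith [sq_nonneg (a * q)]
      have hq0 : q = 0 := (mul_eq_zero.1 hq0).resolve_left ha
      subst hq0
      have hp0 : a * p = 0 := by linarith
      have hp0 : p = 0 := (mul_eq_zero.1 hp0).resolve_left ha
      subst hp0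
      exact hk rfl
    have := pos_of_mul_pos_right hpos (sq_nonneg a)
    linarith

/-- `⟨v, ρ_B v⟩` is the sum over `k` of the nonnegative numbers `⟨k ⊗ v, ρ (k ⊗ v)⟩`, so `ρ` kills
every `k ⊗ v`. -/
theorem mulVec_steeringEllipse_eq_zero {ρ : Matrix (Fin 2 × Fin 2) (Fin 2 × Fin 2) ℂ}
    (hρ : ρ.PosSemidef) {v : Fin 2 → ℂ} (hv : star v ⬝ᵥ (reducedB ρ).mulVec v = 0) (θ : ℝ) :
    (steeringEllipse ρ θ).mulVec v = 0 := by
  let w : Fin 2 → Fin 2 × Fin 2 → ℂ := fun k a => if a.1 = k then v a.2 else 0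
  have hsum : star v ⬝ᵥ (reducedB ρ).mulVec v = ∑ k, star (w k) ⬝ᵥ ρ.mulVec (w k) := by
    simp [w, reducedB, partialTraceA, dotProduct, Matrix.mulVec, Fintype.sum_prod_type,
      Fin.sum_univ_two]
    ring
  have hw : ∀ k, ρ.mulVec (w k) = 0 := by
    intro k
    rw [hsum, Finset.sum_eq_zero_iff_of_nonneg fun k _ => hρ.dotProduct_mulVec_nonneg _] at hv
    exact (hρ.dotProduct_mulVec_zero_iff _).1 (hv k (Finset.mem_univ k))
  ext i
  have h : ∀ k l, ∑ j, ρ (l, i) (k, j) * v j = 0 := by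
    intro k l
    have := congrFun (hw k) (l, i)
    fin_cases k <;>
      simpa [w, Matrix.mulVec, dotProduct, Fintype.sum_prod_type, Fin.sum_univ_two] using this
  simp only [Matrix.mulVec, dotProduct, steeringEllipse_apply, Finset.sum_mul, Pi.zero_apply]
  rw [Finset.sum_comm]
  refine Finset.sum_eq_zero fun k _ => ?_
  rw [Finset.sum_comm]
  refine Finset.sum_eq_zero fun l _ => ?_
  simp only [mul_assoc, ← Finset.mul_sum]
  rw [h, mul_zero]

/-- A null vector of `ρ_B` would be killed by the whole ellipse, hence by its derivative, which is
invertible. -/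
theorem posDef_reducedB {ρ : Matrix (Fin 2 × Fin 2) (Fin 2 × Fin 2) ℂ} (hρ : IsRealDensity ρ)
    (hneg : ∀ θ, symDet (derivCoord ρ θ) < 0) : (reducedB ρ).PosDef := by
  have hpsd : (reducedB ρ).PosSemidef := by
    have : reducedB ρ = ∑ k, ρ.submatrix (fun i => (k, i)) (fun i => (k, i)) := by
      ext i j; simp [reducedB, partialTraceA]
    rw [this]
    exact Matrix.posSemidef_sum _ fun k _ => hρ.posSemidef.submatrix _
  refine Matrix.PosDef.of_dotProduct_mulVec_pos hpsd.isHermitian fun v hv => ?_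
  refine (hpsd.dotProduct_mulVec_nonneg v).lt_of_ne fun h => hv ?_
  have h0 := mulVec_steeringEllipse_eq_zero hρ.posSemidef h.symm
  refine Matrix.eq_zero_of_mulVec_eq_zero (M := symMat (derivCoord ρ 0)) ?_ ?_
  · rw [det_symMat]
    exact_mod_cast (hneg 0).ne
  · rw [symMat_derivCoord hρ, Matrix.smul_mulVec, Matrix.sub_mulVec, h0, h0, sub_zero, smul_zero]

/-! ### Regularity of the derivative curve and conclusion. -/

theorem continuous_derivCoord (ρ : Matrix (Fin 2 × Fin 2) (Fin 2 × Fin 2) ℂ) :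
    Continuous (derivCoord ρ) := by
  unfold derivCoord; fun_prop

theorem derivCoord_add_pi (ρ : Matrix (Fin 2 × Fin 2) (Fin 2 × Fin 2) ℂ) (θ : ℝ) :
    derivCoord ρ (θ + Real.pi) = -derivCoord ρ θ := by
  rw [derivCoord, derivCoord, Real.sin_add_pi, Real.cos_add_pi]
  module

theorem exists_lipschitz_symPair_derivCoord (ρ : Matrix (Fin 2 × Fin 2) (Fin 2 × Fin 2) ℂ)
    (m : ℝ × ℝ × ℝ) : ∃ L, ∀ s t,
      |symPair m (derivCoord ρ s) - symPair m (derivCoord ρ t)| ≤ L * |s - t| := by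
  have e : ∀ θ, symPair m (derivCoord ρ θ) = 1 / 2 * (-Real.sin θ * symPair m (cosCoord ρ) +
      Real.cos θ * symPair m (sinCoord ρ)) := by
    intro θ
    simp only [symPair, derivCoord, Prod.smul_fst, Prod.smul_snd, Prod.fst_add, Prod.snd_add,
      smul_eq_mul]
    ring
  refine ⟨|symPair m (cosCoord ρ)| + |symPair m (sinCoord ρ)|, fun s t => ?_⟩
  set a := symPair m (cosCoord ρ)
  set b := symPair m (sinCoord ρ)
  have e2 : symPair m (derivCoord ρ s) - symPair m (derivCoord ρ t) =
      1 / 2 * ((Real.sin t - Real.sin s) * a + (Real.cos s - Real.cos t) * b) := by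
    rw [e, e]; ring
  have h1 := Real.abs_sin_sub_sin_le t s
  rw [abs_sub_comm t s] at h1
  have h2 := Real.abs_cos_sub_cos_le s t
  rw [e2, abs_mul, abs_of_pos (by norm_num : (0 : ℝ) < 1 / 2)]
  have h3 := abs_add_le ((Real.sin t - Real.sin s) * a) ((Real.cos s - Real.cos t) * b)
  rw [abs_mul, abs_mul] at h3
  nlinarith [mul_le_mul_of_nonneg_right h1 (abs_nonneg a),
    mul_le_mul_of_nonneg_right h2 (abs_nonneg b), abs_nonneg a, abs_nonneg b, abs_nonneg (s - t),
    mul_nonneg (abs_nonneg a) (abs_nonneg (s - t)), mul_nonneg (abs_nonneg b) (abs_nonneg (s - t))]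

theorem continuous_symAbs_comp {X : ℝ → ℝ × ℝ × ℝ} (hX : Continuous X)
    (hneg : ∀ θ, symDet (X θ) < 0) {m : ℝ × ℝ × ℝ} (hd : 0 < symDet m) :
    Continuous fun θ => symAbs m (X θ) := by
  have hpos : ∀ θ, symGap m (X θ) ≠ 0 := fun θ => (symGap_pos hd (hneg θ)).ne'
  have cg := continuous_symGap_comp hX m
  have cp := continuous_symPair_comp hX m
  have cd : Continuous fun θ => symDet (X θ) := continuous_symDet.comp hX
  unfold symAbs
  fun_prop (disch := assumption)

theorem symDet_derivCoord_neg {ρ : Matrix (Fin 2 × Fin 2) (Fin 2 × Fin 2) ℂ}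
    (hρ : IsRealDensity ρ) (htilt : steeringTilt ρ < 1) (θ : ℝ) :
    symDet (derivCoord ρ θ) < 0 := by
  rw [steeringTilt] at htilt
  split_ifs at htilt with h2
  · simp only [iInf_lt_iff] at htilt
    obtain ⟨H, hH, ht⟩ := htilt
    exact symDet_neg_of_trace_eq_zero hH.isHermitian hH.real ht (derivCoord_ne_zero hρ h2 θ)
      (hH.normal _ (symMat_derivCoord_mem hρ θ))
  · simp at htilt

theorem mainTheorem7 (ρ : Matrix (Fin 2 × Fin 2) (Fin 2 × Fin 2) ℂ) (hρ : IsRealDensity ρ)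
    (htilt : steeringTilt ρ < 1) :
    ∃ Y : Matrix (Fin 2) (Fin 2) ℂ, IsPosDefRealDensity Y ∧
      IntervalIntegrable (fun θ : ℝ => absRel Y (deriv (steeringEllipse ρ) θ))
        MeasureTheory.volume 0 (2 * Real.pi) ∧
      ∃ c : ℝ, ∫ θ in (0 : ℝ)..(2 * Real.pi), absRel Y (deriv (steeringEllipse ρ) θ) =
        c • reducedB ρ := by
  have hneg := symDet_derivCoord_neg hρ htilt
  have hX := continuous_derivCoord ρ
  have hB := posDef_reducedB hρ hneg
  have hBs := reducedB_eq_symMat hρ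
  have h0 : 0 < (reducedCoord ρ).1 := (Complex.pos_iff.1 (hB.diag_pos (i := 0))).1
  have hd : 0 < symDet (reducedCoord ρ) := by
    have := hB.det_pos
    rw [hBs, det_symMat] at this
    exact_mod_cast this
  obtain ⟨m, c, hm1, hm2, hmd, e1, e2, e3⟩ := exists_critical hX
    (exists_lipschitz_symPair_derivCoord ρ) (derivCoord_add_pi ρ) hneg h0 hd
  obtain ⟨y, k, hk, hy, hYd⟩ := exists_density_sq hm1 hm2 hmd
  have habs : ∀ θ, absRel (symMat y) (deriv (steeringEllipse ρ) θ) =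
      LinearMap.toContinuousLinearMap symMat (symAbs m (derivCoord ρ θ)) := by
    intro θ
    rw [deriv_steeringEllipse hρ]
    exact absRel_symMat hk ⟨hm1.le, hm2.le, hmd.le⟩ hmd hy (hneg θ)
  have hcont := continuous_symAbs_comp hX hneg hmd
  have hint := hcont.intervalIntegrable (μ := MeasureTheory.volume) 0 (2 * Real.pi)
  refine ⟨symMat y, hYd, ?_, c, ?_⟩
  · simp only [habs]
    exact ((LinearMap.toContinuousLinearMap symMat).continuous.comp hcont).intervalIntegrable _ _
  · simp only [habs]
    rw [ContinuousLinearMap.intervalIntegral_comp_comm _ hint, hBs, ← map_smul]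
    change symMat _ = symMat _
    congr 1
    have f1 := ContinuousLinearMap.intervalIntegral_comp_comm
      (ContinuousLinearMap.fst ℝ ℝ (ℝ × ℝ)) hint
    have f2 := ContinuousLinearMap.intervalIntegral_comp_comm
      ((ContinuousLinearMap.fst ℝ ℝ ℝ).comp (ContinuousLinearMap.snd ℝ ℝ (ℝ × ℝ))) hint
    have f3 := ContinuousLinearMap.intervalIntegral_comp_comm
      ((ContinuousLinearMap.snd ℝ ℝ ℝ).comp (ContinuousLinearMap.snd ℝ ℝ (ℝ × ℝ))) hint
    exact Prod.ext (f1.symm.trans e1) (Prod.ext (f2.symm.trans e2) (f3.symm.trans e3))
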